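/- Let $J=\begin{pmatrix}0&1\\-1&0\end{pmatrix}$ and let $Q:\mathbb{R}\to M_2(\mathbb{C})$ be Hermitian and $\pi$-periodic, with entries integrable on $[0,\pi)$ (equivalently, on compact sets). Write $Q=\begin{pmatrix}q_1&q\\ \bar q&q_2\end{pmatrix}$ with $q_1,q_2$ real-valued, and assume that $Q$ is in canonical form, i.e. $Q=Q_1$, where $$Q_1=\operatorname{Re}(q)\begin{pmatrix}0&1\\1&0\end{pmatrix}+\tfrac12(q_1-q_2)\begin{pmatrix}1&0\\0&-1\end{pmatrix}$$ (in other words, $q$ is real-valued and $q_2=-q_1$). For $\lambda\in\mathbb{C}$ let $\mathbb{Y}(\cdot,\lambda):\mathbb{R}\to M_2(\mathbb{C})$ be the matrix solution, with entries absolutely continuous on compact intervals, of $J\mathbb{Y}'+Q\mathbb{Y}=\lambda\mathbb{Y}$ a.e. with $\mathbb{Y}(0,\lambda)=\mathbb{I}$, and let $\Delta(\lambda)=\operatorname{tr}\mathbb{Y}(\pi,\lambda)$ be the discriminant. Then: (a) $Q(z+\frac{\pi}{2})=Q(z)$ for a.e. $z\in\mathbb{R}$ if and only if every zero $\lambda\in\mathbb{C}$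 of $\Delta+2$ has multiplicity exactly $2$; (b) $Q(z+\frac{\pi}{2})=-Q(z)$ for a.e. $z\in\mathbb{R}$ if and only if every zero $\lambda\in\mathbb{C}$ of $\Delta-2$ has multiplicity exactly $2$. -/

import Mathlib

open MeasureTheory

noncomputable section

namespace DiracSystem

/-- The matrix `J` of the differential expression `ℓ Y = J Y' + Q Y`. -/
def J : Matrix (Fin 2) (Fin 2) ℂ := !![0, 1; -1, 0]

/-- The Pauli matrix `σ₁`. -/
def sigma1 : Matrix (Fin 2) (Fin 2) ℂ := !![0, 1; 1, 0]

/-- The Pauli matrix `σ₃`. -/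
def sigma3 : Matrix (Fin 2) (Fin 2) ℂ := !![1, 0; 0, -1]

/-- The component `A₁ = Re(q) σ₁ + ½ (q₁ - q₂) σ₃` of a Hermitian matrix
`A = (q₁, q; q*, q₂)` that anticommutes with `J`. -/
def antiPart (A : Matrix (Fin 2) (Fin 2) ℂ) : Matrix (Fin 2) (Fin 2) ℂ :=
  ((A 0 1).re : ℂ) • sigma1 + ((A 0 0 - A 1 1) / 2) • sigma3

/-- A potential `Q` is in canonical form if `Q = Q₁`. -/
def IsCanonical (Q : ℝ → Matrix (Fin 2) (Fin 2) ℂ) : Prop :=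
  ∀ z, Q z = antiPart (Q z)

/-- The entrywise derivative of a matrix-valued function of a real variable. -/
def entryDeriv (Y : ℝ → Matrix (Fin 2) (Fin 2) ℂ) (z : ℝ) : Matrix (Fin 2) (Fin 2) ℂ :=
  Matrix.of fun i j => deriv (fun t => Y t i j) z

/-- `Y = [Y₁ Y₂]` is the fundamental matrix of `J Y' + Q Y = lam Y` with `Y(0) = 𝕀`: its entries
are absolutely continuous on every compact interval (hence differentiable almost everywhere)
and the equation holds almost everywhere on `ℝ`. -/
structure IsFundamentalMatrix (Q : ℝ → Matrix (Fin 2) (Fin 2) ℂ) (lam : ℂ)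
    (Y : ℝ → Matrix (Fin 2) (Fin 2) ℂ) : Prop where
  absCont : ∀ (i j : Fin 2) (a b : ℝ), AbsolutelyContinuousOnInterval (fun z => Y z i j) a b
  ode : ∀ᵐ z : ℝ, J * entryDeriv Y z + Q z * Y z = lam • Y z
  init : Y 0 = 1

open Classical in
/-- The fundamental matrix `𝕐(z)` of `ℓ Y = lam Y`. When the entries of `Q` are integrable on
compact sets, exactly one function satisfies `IsFundamentalMatrix Q lam` (linear systems with
locally integrable coefficients), and this is that function; the value `0` is used only
if there is no such function. -/
def fundamentalMatrix (Q : ℝ → Matrix (Fin 2) (Fin 2) ℂ) (lam : ℂ) :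
    ℝ → Matrix (Fin 2) (Fin 2) ℂ :=
  if h : ∃ Y, IsFundamentalMatrix Q lam Y then h.choose else 0

/-- The discriminant `Δ(lam) = y₁₁(π) + y₂₂(π)`, the trace of the monodromy matrix. -/
def discriminant (Q : ℝ → Matrix (Fin 2) (Fin 2) ℂ) (lam : ℂ) : ℂ :=
  (fundamentalMatrix Q lam Real.pi).trace

/-- Every zero of `f` in the complex plane has multiplicity exactly two. -/
def HasOnlyDoubleZeros (f : ℂ → ℂ) : Prop :=
  ∀ lam : ℂ, f lam = 0 → analyticOrderAt f lam = 2

end DiracSystem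

end

/-! Write `Q = (p, q; q, -p)`, let `Y(z, l)` be the fundamental matrix and `M(l) = Y(π, l)`. Both
parts are one statement about a sign `σ = ±1`: `Q(z + π/2) = σ Q(z)` a.e. iff every zero of `Δ + 2σ`
is double.

Periodicity gives double zeros. Put `R = 1` for `σ = 1` and `R = J` for `σ = -1`. Then `R Y` solves
the half-shifted system, so `N = R Y(π/2)` satisfies `N² = σ M` and `det N = 1`. Cayley–Hamilton
gives `Δ + 2σ = σ (tr N)²`, and the zeros of `tr N` are simple: for a real unimodular matrix with
`|tr| ≤ 2`, a vanishing spectral derivative of the trace forces a scalar matrix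
(`eq_smul_one_of_trace_eq_zero`), and no scalar matrix has trace 0 and determinant 1.

Double zeros give periodicity. By the same lemma `M = -σ` at each zero of `Δ + 2σ`
(`fundMat_pi_eq`). Let `T_t` be the transition matrix from `t` to `t + π/2` and `X_t = adj T_{t+π/2}
+ σ T_t`. Then `X_t Y(t) = Y(t + π/2) (adj M + σ)`, so every entry of `X_t` vanishes at every zero
of `Δ + 2σ`. A product of two such entries is thus divisible by `Δ + 2σ`. Each entry of `X_t` grows
at most like `exp(|Im l| π/2)`, while `Δ + 2σ` is bounded below by `exp(|Im l| π)` up to a factor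
degenerating quadratically on the real axis (`exists_trace_lower_bound`). A Liouville argument makes
the quotient constant, and the asymptotics as `Im l → ∞` identify the constant
(`comparison_mul_comparison`). At the single point `l = i` this shows that `X_t(i)` is a matrix `α +
βJ` independent of `t`. Hence `(α + βJ) Y` is a fundamental system for both `Q(· + π/2)` and `σ Q`,
and the two potentials coincide a.e. -/

namespace DiracSystem

open Set Filter Topology intervalIntegral

/-! ### Calculus of locally absolutely continuous functions, and Grönwall's inequality -/

section ACPrimitive

variable {E : Type*} [NormedAddCommGroup E] [NormedSpace ℝ E]

/-- `F` is locally absolutely continuous on `ℝ` with almost everywhere derivative `f`. -/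
structure IsACPrimitive (F f : ℝ → E) : Prop where
  ac : ∀ a b, AbsolutelyContinuousOnInterval F a b
  hasDerivAt : ∀ᵐ x, HasDerivAt F (f x) x

namespace IsACPrimitive

variable {F f G g : ℝ → E}

theorem congr (hF : IsACPrimitive F f) (h : f =ᵐ[volume] g) : IsACPrimitive F g :=
  ⟨hF.ac, by filter_upwards [hF.hasDerivAt, h] with x hx hfx using hfx ▸ hx⟩

theorem continuous (hF : IsACPrimitive F f) : Continuous F := by
  rw [continuous_iff_continuousAt]
  intro x
  refine (hF.ac (x - 1) (x + 1)).continuousOn.continuousAt ?_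
  rw [uIcc_of_le (by linarith)]
  exact Icc_mem_nhds (by linarith) (by linarith)

theorem const (c : E) : IsACPrimitive (fun _ => c) (fun _ => 0) :=
  ⟨fun _ _ => (contDiff_const.contDiffOn).absolutelyContinuousOnInterval,
    Eventually.of_forall fun x => hasDerivAt_const x c⟩

theorem add (hF : IsACPrimitive F f) (hG : IsACPrimitive G g) :
    IsACPrimitive (fun x => F x + G x) (fun x => f x + g x) :=
  ⟨fun a b => (hF.ac a b).add (hG.ac a b), by
    filter_upwards [hF.hasDerivAt, hG.hasDerivAt] with x h1 h2 using h1.add h2⟩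

theorem sub (hF : IsACPrimitive F f) (hG : IsACPrimitive G g) :
    IsACPrimitive (fun x => F x - G x) (fun x => f x - g x) :=
  ⟨fun a b => (hF.ac a b).sub (hG.ac a b), by
    filter_upwards [hF.hasDerivAt, hG.hasDerivAt] with x h1 h2 using h1.sub h2⟩

theorem of_contDiff (hF : ContDiff ℝ 1 F) : IsACPrimitive F (deriv F) :=
  ⟨fun _ _ => hF.contDiffOn.absolutelyContinuousOnInterval,
    Eventually.of_forall fun x => (hF.differentiable one_ne_zero x).hasDerivAt⟩

theorem mul {𝔸 : Type*} [NormedRing 𝔸] [NormMulClass 𝔸] [NormedAlgebra ℝ 𝔸] {F f G g : ℝ → 𝔸}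
    (hF : IsACPrimitive F f) (hG : IsACPrimitive G g) :
    IsACPrimitive (fun x => F x * G x) (fun x => f x * G x + F x * g x) :=
  ⟨fun a b => (hF.ac a b).smul (hG.ac a b), by
    filter_upwards [hF.hasDerivAt, hG.hasDerivAt] with x h1 h2 using h1.mul h2⟩

theorem const_mul {𝔸 : Type*} [NormedRing 𝔸] [NormMulClass 𝔸] [NormedAlgebra ℝ 𝔸] {F f : ℝ → 𝔸}
    (c : 𝔸) (hF : IsACPrimitive F f) : IsACPrimitive (fun x => c * F x) (fun x => c * f x) := by
  simpa using (const c).mul hF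

theorem comp_clm {E' : Type*} [NormedAddCommGroup E'] [NormedSpace ℝ E'] (L : E →L[ℝ] E')
    (hF : IsACPrimitive F f) : IsACPrimitive (fun x => L (F x)) (fun x => L (f x)) := by
  refine ⟨fun a b => ?_, by
    filter_upwards [hF.hasDerivAt] with x hx using L.hasFDerivAt.comp_hasDerivAt x hx⟩
  have h := Tendsto.const_mul ‖L‖ (hF.ac a b)
  rw [mul_zero] at h
  refine squeeze_zero (fun t => Finset.sum_nonneg fun i _ => dist_nonneg) (fun t => ?_) h
  rw [Finset.mul_sum]
  refine Finset.sum_le_sum fun i _ => ?_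
  rw [dist_eq_norm, dist_eq_norm, ← map_sub]
  exact L.le_opNorm _

/-- A locally absolutely continuous function with vanishing derivative is constant. -/
theorem eq_of_zero (hF : IsACPrimitive F (fun _ => 0)) (x y : ℝ) : F x = F y := by
  obtain ⟨C, hC⟩ := (hF.ac x y).const_of_ae_hasDerivAt_zero
    (by filter_upwards [hF.hasDerivAt] with z hz _ using hz)
  rw [hC x (by simp), hC y (by simp)]

end IsACPrimitive

end ACPrimitive

end DiracSystem

namespace DiracSystem

open Set Filter Topology intervalIntegral

namespace IsACPrimitive

theorem intervalIntegrable_real {F f : ℝ → ℝ} (hF : IsACPrimitive F f) (a b : ℝ) :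
    IntervalIntegrable f volume a b := by
  refine (hF.ac a b).intervalIntegrable_deriv.congr_ae ?_
  filter_upwards [ae_restrict_of_ae hF.hasDerivAt] with x hx using hx.deriv

theorem integral_real {F f : ℝ → ℝ} (hF : IsACPrimitive F f) (a b : ℝ) :
    ∫ x in a..b, f x = F b - F a := by
  rw [← (hF.ac a b).integral_deriv_eq_sub]
  refine integral_congr_ae ?_
  filter_upwards [hF.hasDerivAt] with x hx _ using hx.deriv.symm

theorem re {F f : ℝ → ℂ} (hF : IsACPrimitive F f) :
    IsACPrimitive (fun x => (F x).re) (fun x => (f x).re) := hF.comp_clm Complex.reCLM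

theorem im {F f : ℝ → ℂ} (hF : IsACPrimitive F f) :
    IsACPrimitive (fun x => (F x).im) (fun x => (f x).im) := hF.comp_clm Complex.imCLM

theorem ofReal {F f : ℝ → ℝ} (hF : IsACPrimitive F f) :
    IsACPrimitive (fun x => (F x : ℂ)) (fun x => (f x : ℂ)) := hF.comp_clm Complex.ofRealCLM

theorem conj {F f : ℝ → ℂ} (hF : IsACPrimitive F f) :
    IsACPrimitive (fun x => (starRingEnd ℂ) (F x)) (fun x => (starRingEnd ℂ) (f x)) :=
  hF.comp_clm (Complex.conjCLE : ℂ →L[ℝ] ℂ)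

theorem intervalIntegrable {F f : ℝ → ℂ} (hF : IsACPrimitive F f) (a b : ℝ) :
    IntervalIntegrable f volume a b := by
  have h1 := (hF.re.intervalIntegrable_real a b)
  have h2 := (hF.im.intervalIntegrable_real a b)
  have h3 : IntervalIntegrable (fun x => ((f x).re : ℂ)) volume a b :=
    ⟨h1.1.ofReal, h1.2.ofReal⟩
  have h4 : IntervalIntegrable (fun x => ((f x).im : ℂ)) volume a b :=
    ⟨h2.1.ofReal, h2.2.ofReal⟩
  have := h3.add (h4.mul_const Complex.I)
  simpa [Complex.re_add_im] using this

theorem of_integral_real {f : ℝ → ℝ} (hf : ∀ a b, IntervalIntegrable f volume a b) (c : ℝ) :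
    IsACPrimitive (fun x => ∫ t in c..x, f t) f := by
  refine ⟨fun a b => ?_, ?_⟩
  · have := (hf (min a (min b c)) (max a (max b c))).absolutelyContinuousOnInterval_intervalIntegral
      (c := c) (by rw [uIcc_of_le (by simp)]; simp)
    refine this.mono (uIcc_subset_uIcc ?_ ?_) <;> rw [uIcc_of_le (by simp)] <;> simp
  · have := LocallyIntegrable.ae_hasDerivAt_integral (f := f) (fun x => ⟨Ioc (x - 1) (x + 1),
      Ioc_mem_nhds (by linarith) (by linarith), (hf (x - 1) (x + 1)).1⟩)
    filter_upwards [this] with x hx using hx c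

theorem of_integral {f : ℝ → ℂ} (hf : ∀ a b, IntervalIntegrable f volume a b) (c : ℝ) :
    IsACPrimitive (fun x => ∫ t in c..x, f t) f := by
  have hre : ∀ a b, IntervalIntegrable (fun x => (f x).re) volume a b :=
    fun a b => ⟨(hf a b).1.re, (hf a b).2.re⟩
  have him : ∀ a b, IntervalIntegrable (fun x => (f x).im) volume a b :=
    fun a b => ⟨(hf a b).1.im, (hf a b).2.im⟩
  have h := (of_integral_real hre c).ofReal.add
    ((of_integral_real him c).ofReal.const_mul Complex.I)
  have e1 : (fun x => ((f x).re : ℂ) + Complex.I * ((f x).im : ℂ)) = f := by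
    funext x; rw [mul_comm]; exact Complex.re_add_im _
  have e2 : (fun x => (((∫ t in c..x, (f t).re) : ℝ) : ℂ) +
      Complex.I * ((∫ t in c..x, (f t).im : ℝ) : ℂ))
      = fun x => ∫ t in c..x, f t := by
    funext x
    rw [← intervalIntegral.integral_ofReal, ← intervalIntegral.integral_ofReal,
      ← intervalIntegral.integral_const_mul, ← intervalIntegral.integral_add]
    · exact congrArg (fun g => ∫ t in c..x, g t) e1
    · exact ⟨(hre c x).1.ofReal, (hre c x).2.ofReal⟩
    · exact IntervalIntegrable.const_mul ⟨(him c x).1.ofReal, (him c x).2.ofReal⟩ _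
  rwa [e1, e2] at h

theorem integral {F f : ℝ → ℂ} (hF : IsACPrimitive F f) (a b : ℝ) :
    ∫ x in a..b, f x = F b - F a := by
  have := (hF.sub (of_integral hF.intervalIntegrable a)).congr (g := fun _ => 0)
    (by simp)
  have := this.eq_of_zero a b
  simp at this
  rw [this]; ring

/-- The translate is recovered as `F c` plus the integral of the translated derivative, so both
properties follow from `of_integral`. -/
theorem comp_add {F f : ℝ → ℂ} (hF : IsACPrimitive F f) (c : ℝ) :
    IsACPrimitive (fun x => F (x + c)) (fun x => f (x + c)) := by
  have hi : ∀ a b, IntervalIntegrable (fun x => f (x + c)) volume a b := fun a b => by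
    have := (hF.intervalIntegrable (a + c) (b + c)).comp_add_right c
    simpa using this
  have h := (IsACPrimitive.const (F c)).add (of_integral hi 0)
  simp only [zero_add] at h
  convert h using 2 with x
  rw [intervalIntegral.integral_comp_add_right, hF.integral]
  simp

/-- Composition of a real locally absolutely continuous function with the exponential. -/
theorem exp {F f : ℝ → ℝ} (hF : IsACPrimitive F f) :
    IsACPrimitive (fun x => Real.exp (F x)) (fun x => f x * Real.exp (F x)) := by
  refine ⟨fun a b => ?_, ?_⟩
  · obtain ⟨C, hC⟩ := (hF.ac a b).exists_bound
    obtain ⟨K, hK⟩ := (Real.contDiff_exp (n := 1)).contDiffOn.exists_lipschitzOnWith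
      (by decide) (convex_Icc (-C) C) isCompact_Icc
    rw [absolutelyContinuousOnInterval_iff]
    intro ε hε
    -- `K` is a Lipschitz constant of `exp` on the range of `F`; `K + 1` keeps the divisor positive.
    obtain ⟨δ, hδ, h⟩ := (absolutelyContinuousOnInterval_iff _ _ _).1 (hF.ac a b) (ε / (K + 1))
      (by positivity)
    refine ⟨δ, hδ, fun I hI hlt => ?_⟩
    have h1 := h I hI hlt
    have hm : ∀ x ∈ uIcc a b, F x ∈ Icc (-C) C := fun x hx => by
      have := hC x hx
      rw [Real.norm_eq_abs, abs_le] at this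
      exact this
    calc _ ≤ ∑ i ∈ Finset.range I.1, (K : ℝ) * dist (F (I.2 i).1) (F (I.2 i).2) :=
          Finset.sum_le_sum fun i hi =>
            hK.dist_le_mul _ (hm _ (hI.1 i hi).1) _ (hm _ (hI.1 i hi).2)
      _ = K * ∑ i ∈ Finset.range I.1, dist (F (I.2 i).1) (F (I.2 i).2) := by
          rw [Finset.mul_sum]
      _ ≤ (K + 1) * ∑ i ∈ Finset.range I.1, dist (F (I.2 i).1) (F (I.2 i).2) := by
          gcongr; linarith
      _ < ε := by rwa [lt_div_iff₀' (by positivity)] at h1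
  · filter_upwards [hF.hasDerivAt] with x hx
    simpa [mul_comm] using hx.exp

theorem antitone_of_nonpos {F f : ℝ → ℝ} (hF : IsACPrimitive F f) {a b : ℝ} (hab : a ≤ b)
    (hf : ∀ᵐ x, x ∈ Ioc a b → f x ≤ 0) : F b ≤ F a := by
  have h := hF.integral_real a b
  have : ∫ x in a..b, f x ≤ 0 := by
    rw [integral_of_le hab]
    refine setIntegral_nonpos_ae measurableSet_Ioc hf
  linarith

end IsACPrimitive

/-- Grönwall's inequality with an integrable coefficient. -/
theorem le_mul_exp_of_le_integral {u k : ℝ → ℝ} {c L : ℝ} (hu : Continuous u)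
    (hk : ∀ a b, IntervalIntegrable k volume a b) (hk0 : ∀ x, 0 ≤ k x)
    (h : ∀ z ∈ Icc 0 L, u z ≤ c + ∫ x in (0 : ℝ)..z, k x * u x) {z : ℝ} (hz : z ∈ Icc 0 L) :
    u z ≤ c * Real.exp (∫ x in (0 : ℝ)..z, k x) := by
  have hku : ∀ a b, IntervalIntegrable (fun x => k x * u x) volume a b :=
    fun a b => (hk a b).mul_continuousOn hu.continuousOn
  have hκ := IsACPrimitive.of_integral_real hk 0
  have hm := ((IsACPrimitive.const c).add (IsACPrimitive.of_integral_real hku 0)).mul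
    (hκ.const_mul (-1)).exp
  -- The product `(c + ∫ k u) exp(-∫ k)` has derivative `k (u - c - ∫ k u) exp(-∫ k)`, which the
  -- hypothesis makes nonpositive.
  have := hm.antitone_of_nonpos hz.1 (Eventually.of_forall fun x hx => by
    have h1 := h x ⟨hx.1.le, hx.2.trans hz.2⟩
    have h2 := Real.exp_pos (-1 * ∫ t in (0:ℝ)..x, k t)
    have h3 := mul_le_mul_of_nonneg_left h1 (hk0 x)
    have h4 := mul_le_mul_of_nonneg_right h3 h2.le
    linarith)
  simp only [integral_same, add_zero, mul_zero, Real.exp_zero, mul_one, neg_mul, one_mul,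
    Real.exp_neg] at this
  have h2 := Real.exp_pos (∫ t in (0:ℝ)..z, k t)
  rw [← div_eq_mul_inv, div_le_iff₀ h2] at this
  exact (h z hz).trans this

end DiracSystem

/-! ### Global solutions of linear Volterra equations -/

namespace DiracSystem

open Set Filter Topology intervalIntegral
open scoped BoundedContinuousFunction

/-- On each half-line the integrand is, up to sign, the derivative of half the exponential weight.
The factor 2 in the exponent becomes the contraction constant 1/2 below. -/
theorem abs_integral_mul_exp_le {k : ℝ → ℝ} (hk : ∀ a b, IntervalIntegrable k volume a b)
    (hk0 : ∀ x, 0 ≤ k x) (z : ℝ) :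
    |∫ x in (0 : ℝ)..z, k x * Real.exp (2 * |∫ t in (0 : ℝ)..x, k t|)| ≤
      Real.exp (2 * |∫ t in (0 : ℝ)..z, k t|) / 2 := by
  have hκ := IsACPrimitive.of_integral_real hk 0
  rcases le_total 0 z with hz | hz
  · have hpos : ∀ x, 0 ≤ x → 0 ≤ ∫ t in (0 : ℝ)..x, k t :=
      fun x hx => integral_nonneg hx fun t _ => hk0 t
    have h := ((hκ.const_mul 2).exp.const_mul (1 / 2)).integral_real 0 z
    have e : ∫ x in (0 : ℝ)..z, k x * Real.exp (2 * |∫ t in (0 : ℝ)..x, k t|) =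
        ∫ x in (0 : ℝ)..z, 1 / 2 * (2 * k x * Real.exp (2 * ∫ t in (0 : ℝ)..x, k t)) := by
      refine integral_congr fun x hx => ?_
      rw [uIcc_of_le hz] at hx
      simp only [abs_of_nonneg (hpos x hx.1)]
      ring
    rw [e, h, abs_of_nonneg (hpos z hz)]
    have : 1 ≤ Real.exp (2 * ∫ t in (0 : ℝ)..z, k t) :=
      Real.one_le_exp (mul_nonneg zero_le_two (hpos z hz))
    simp only [integral_same, mul_zero, Real.exp_zero]
    rw [abs_le]; constructor <;> linarith
  · have hneg : ∀ x, x ≤ 0 → ∫ t in (0 : ℝ)..x, k t ≤ 0 := fun x hx => by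
      rw [integral_symm]
      exact neg_nonpos.2 (integral_nonneg hx fun t _ => hk0 t)
    have h := ((hκ.const_mul (-2)).exp.const_mul (-1 / 2)).integral_real 0 z
    have e : ∫ x in (0 : ℝ)..z, k x * Real.exp (2 * |∫ t in (0 : ℝ)..x, k t|) =
        ∫ x in (0 : ℝ)..z, -1 / 2 * (-2 * k x * Real.exp (-2 * ∫ t in (0 : ℝ)..x, k t)) := by
      refine integral_congr fun x hx => ?_
      rw [uIcc_of_ge hz] at hx
      simp only [abs_of_nonpos (hneg x hx.2), mul_neg, neg_mul]
      ring
    rw [e, h, abs_of_nonpos (hneg z hz), mul_neg, ← neg_mul]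
    have : 1 ≤ Real.exp (-2 * ∫ t in (0 : ℝ)..z, k t) :=
      Real.one_le_exp (mul_nonneg_of_nonpos_of_nonpos (by norm_num) (hneg z hz))
    simp only [integral_same, mul_zero, Real.exp_zero]
    rw [abs_le]; constructor <;> linarith

/-- Linear Volterra equations with locally integrable coefficient have global solutions. -/
theorem exists_volterra_solution {𝔸 : Type*} [NormedRing 𝔸] [NormedAlgebra ℝ 𝔸] [CompleteSpace 𝔸]
    {K : ℝ → 𝔸} (hK : ∀ a b, IntervalIntegrable K volume a b) (y : 𝔸) :
    ∃ Y : ℝ → 𝔸, Continuous Y ∧ ∀ z, Y z = y + ∫ s in (0 : ℝ)..z, K s * Y s := by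
  set k : ℝ → ℝ := fun x => ‖K x‖ with hkdef
  have hk : ∀ a b, IntervalIntegrable k volume a b := fun a b => (hK a b).norm
  have hk0 : ∀ x, 0 ≤ k x := fun x => norm_nonneg _
  -- In the sup norm weighted by `1 / w` the Volterra operator is a contraction on the whole line,
  -- so no gluing of local solutions is needed.
  set w : ℝ → ℝ := fun z => Real.exp (2 * |∫ t in (0 : ℝ)..z, k t|) with hw
  have hwc : Continuous w := by
    have := (IsACPrimitive.of_integral_real hk 0).continuous
    fun_prop
  have hw1 : ∀ z, 1 ≤ w z := fun z => Real.one_le_exp (by positivity)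
  have hw0 : ∀ z, 0 < w z := fun z => Real.exp_pos _
  have hint : ∀ v : ℝ → 𝔸, Continuous v → ∀ a b,
      IntervalIntegrable (fun s => K s * (w s • v s)) volume a b := fun v hv a b =>
    (hK a b).mul_continuousOn (hwc.smul hv).continuousOn
  have hbound : ∀ (v : ℝ → 𝔸) (C : ℝ), (∀ s, ‖v s‖ ≤ C) → ∀ z,
      ‖∫ s in (0 : ℝ)..z, K s * (w s • v s)‖ ≤ C * (w z / 2) := by
    intro v C hv z
    have hkw : ∀ a b, IntervalIntegrable (fun x => C * (k x * w x)) volume a b := fun a b =>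
      ((hk a b).mul_continuousOn hwc.continuousOn).const_mul C
    have hC : 0 ≤ C := (norm_nonneg _).trans (hv 0)
    have h1 : ‖∫ s in (0 : ℝ)..z, K s * (w s • v s)‖ ≤ |∫ s in (0 : ℝ)..z, C * (k s * w s)| := by
      refine norm_integral_le_abs_of_norm_le (Eventually.of_forall fun s => ?_) (hkw 0 z)
      calc ‖K s * (w s • v s)‖ ≤ ‖K s‖ * ‖w s • v s‖ := norm_mul_le _ _
        _ = k s * (w s * ‖v s‖) := by rw [norm_smul, Real.norm_of_nonneg (hw0 s).le]
        _ ≤ k s * (w s * C) := by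
          have := hk0 s; have := (hw0 s).le; gcongr; exact hv s
        _ = C * (k s * w s) := by ring
    refine h1.trans ?_
    rw [intervalIntegral.integral_const_mul, abs_mul, abs_of_nonneg hC]
    exact mul_le_mul_of_nonneg_left (abs_integral_mul_exp_le hk hk0 z) hC
  have hcont : ∀ v : ℝ → 𝔸, Continuous v →
      Continuous fun z => (w z)⁻¹ • (y + ∫ s in (0 : ℝ)..z, K s * (w s • v s)) := fun v hv =>
    (hwc.inv₀ fun z => (hw0 z).ne').smul
      (continuous_const.add (continuous_primitive (hint v hv) 0))
  -- The unknown is rescaled to `v = Y / w`, which is a bounded function.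
  let Φ : (ℝ →ᵇ 𝔸) → (ℝ →ᵇ 𝔸) := fun v =>
    BoundedContinuousFunction.ofNormedAddCommGroup _ (hcont v v.continuous) (‖y‖ + ‖v‖)
      (fun z => by
        rw [norm_smul, norm_inv, Real.norm_of_nonneg (hw0 z).le]
        rw [inv_mul_le_iff₀ (hw0 z)]
        refine (norm_add_le _ _).trans ?_
        have := hbound v ‖v‖ v.norm_coe_le_norm z
        have h2 := norm_nonneg y
        have h3 := norm_nonneg v
        nlinarith [hw1 z, mul_nonneg h3 (hw0 z).le])
  have hΦ : ∀ v z, Φ v z = (w z)⁻¹ • (y + ∫ s in (0 : ℝ)..z, K s * (w s • v s)) := fun _ _ => rfl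
  have hcontr : ContractingWith (1 / 2) Φ := by
    refine ⟨by
      rw [← NNReal.coe_lt_coe]; norm_num, LipschitzWith.of_dist_le_mul fun v v' => ?_⟩
    rw [BoundedContinuousFunction.dist_le (by positivity)]
    intro z
    have hsub : Φ v z - Φ v' z =
        (w z)⁻¹ • ∫ s in (0 : ℝ)..z, K s * (w s • (v s - v' s)) := by
      rw [hΦ, hΦ, ← smul_sub, add_sub_add_left_eq_sub,
        ← intervalIntegral.integral_sub (hint v v.continuous 0 z) (hint v' v'.continuous 0 z)]
      simp only [← mul_sub, ← smul_sub]
    rw [dist_eq_norm, hsub, norm_smul, norm_inv, Real.norm_of_nonneg (hw0 z).le,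
      inv_mul_le_iff₀ (hw0 z)]
    refine (hbound (fun s => v s - v' s) (dist v v') (fun s => ?_) z).trans (le_of_eq ?_)
    · rw [← dist_eq_norm]; exact BoundedContinuousFunction.dist_coe_le_dist s
    · push_cast; ring
  let v := ContractingWith.fixedPoint Φ hcontr
  have hv : Φ v = v := hcontr.fixedPoint_isFixedPt
  refine ⟨fun z => w z • v z, hwc.smul v.continuous, fun z => ?_⟩
  have := hΦ v z
  rw [hv] at this
  simp only
  rw [this, smul_inv_smul₀ (hw0 z).ne']

end DiracSystem

/-! ### The canonical system: solutions, Wronskians, fundamental matrices -/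

namespace DiracSystem

open Set Filter Topology intervalIntegral

/-- `(u, v)` solves `J y' + Q y = l y` almost everywhere, where `Q = (p, q; q, -p)`. -/
structure IsSolution (p q : ℝ → ℝ) (l : ℂ) (u v : ℝ → ℂ) : Prop where
  fst : IsACPrimitive u fun z => q z * u z - (p z + l) * v z
  snd : IsACPrimitive v fun z => (l - p z) * u z - q z * v z

variable {p q : ℝ → ℝ} {l m : ℂ} {u v u' v' : ℝ → ℂ}

theorem exists_isSolution (hp : ∀ a b, IntervalIntegrable p volume a b)
    (hq : ∀ a b, IntervalIntegrable q volume a b) (l a b : ℂ) :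
    ∃ u v, IsSolution p q l u v ∧ u 0 = a ∧ v 0 = b := by
  let π₁ := ContinuousLinearMap.fst ℝ ℂ ℂ
  let π₂ := ContinuousLinearMap.snd ℝ ℂ ℂ
  -- The coefficient acts as an operator on `ℂ × ℂ`; the operator-valued equation with initial value
  -- 1 is solved and then applied to `(a, b)`.
  let K : ℝ → (ℂ × ℂ →L[ℝ] ℂ × ℂ) := fun s =>
    q s • π₁.prod (-π₂) + p s • (-π₂).prod (-π₁) + (-(l • π₂)).prod (l • π₁)
  have hsmul : ∀ f : ℝ → ℝ, (∀ a b, IntervalIntegrable f volume a b) →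
      ∀ (C : ℂ × ℂ →L[ℝ] ℂ × ℂ) (a b : ℝ), IntervalIntegrable (fun s => f s • C) volume a b :=
    fun f hf C a b => ⟨Integrable.smul_const (hf a b).1 C, Integrable.smul_const (hf a b).2 C⟩
  have hK : ∀ a b, IntervalIntegrable K volume a b := fun a b =>
    ((hsmul q hq _ a b).add (hsmul p hp _ a b)).add intervalIntegrable_const
  obtain ⟨Y, hYc, hY⟩ := exists_volterra_solution hK 1
  have hi : ∀ a b, IntervalIntegrable (fun s => K s * Y s) volume a b := fun a b =>
    (hK a b).mul_continuousOn hYc.continuousOn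
  have key : ∀ L : (ℂ × ℂ →L[ℝ] ℂ × ℂ) →L[ℝ] ℂ,
      IsACPrimitive (fun z => L (Y z)) (fun z => L (K z * Y z)) := by
    intro L
    have hLi : ∀ a b, IntervalIntegrable (fun s => L (K s * Y s)) volume a b := fun a b =>
      ⟨L.integrable_comp (hi a b).1, L.integrable_comp (hi a b).2⟩
    have := (IsACPrimitive.const (L 1)).add (IsACPrimitive.of_integral hLi 0)
    simp only [zero_add] at this
    convert this using 2 with z
    rw [L.intervalIntegral_comp_comm (hi 0 z), ← map_add, ← hY z]
  let ev := ContinuousLinearMap.apply ℝ (ℂ × ℂ) (a, b)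
  refine ⟨fun z => (Y z (a, b)).1, fun z => (Y z (a, b)).2, ⟨?_, ?_⟩, ?_, ?_⟩
  · refine (key (π₁ ∘L ev)).congr (Eventually.of_forall fun z => ?_)
    simp [K, π₁, π₂, ev]; ring
  · refine (key (π₂ ∘L ev)).congr (Eventually.of_forall fun z => ?_)
    simp [K, π₁, π₂, ev]; ring
  · simp [hY 0]
  · simp [hY 0]

namespace IsSolution

theorem linear_comb (h : IsSolution p q l u v) (h' : IsSolution p q l u' v') (a b : ℂ) :
    IsSolution p q l (fun z => a * u z + b * u' z) (fun z => a * v z + b * v' z) :=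
  ⟨((h.fst.const_mul a).add (h'.fst.const_mul b)).congr (Eventually.of_forall fun z => by ring),
    ((h.snd.const_mul a).add (h'.snd.const_mul b)).congr (Eventually.of_forall fun z => by ring)⟩

theorem conj (h : IsSolution p q l u v) :
    IsSolution p q (starRingEnd ℂ l) (fun z => starRingEnd ℂ (u z))
      (fun z => starRingEnd ℂ (v z)) :=
  ⟨h.fst.conj.congr (Eventually.of_forall fun z => by simp),
    h.snd.conj.congr (Eventually.of_forall fun z => by simp)⟩

theorem shift (h : IsSolution p q l u v) (t : ℝ) :
    IsSolution (fun z => p (z + t)) (fun z => q (z + t)) l (fun z => u (z + t))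
      (fun z => v (z + t)) :=
  ⟨h.fst.comp_add t, h.snd.comp_add t⟩

/-- Lagrange's identity. -/
theorem lagrange (h : IsSolution p q l u v) (h' : IsSolution p q m u' v') :
    IsACPrimitive (fun z => u z * v' z - v z * u' z)
      (fun z => (m - l) * (u z * u' z + v z * v' z)) :=
  ((h.fst.mul h'.snd).sub (h.snd.mul h'.fst)).congr (Eventually.of_forall fun z => by
    simp only; ring)

theorem wronskian_eq (h : IsSolution p q l u v) (h' : IsSolution p q l u' v') (z : ℝ) :
    u z * v' z - v z * u' z = u 0 * v' 0 - v 0 * u' 0 :=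
  ((h.lagrange h').congr (g := fun _ => 0) (by simp)).eq_of_zero z 0

/-- The energy identity for `Im (conj u * v)`. -/
theorem energy (h : IsSolution p q l u v) :
    IsACPrimitive (fun z => (starRingEnd ℂ (u z) * v z).im)
      (fun z => l.im * (‖u z‖ ^ 2 + ‖v z‖ ^ 2)) := by
  have key := (h.conj.lagrange h).im.const_mul (1 / 2)
  have e : (fun z => 1 / 2 * (starRingEnd ℂ (u z) * v z - starRingEnd ℂ (v z) * u z).im) =
      fun z => (starRingEnd ℂ (u z) * v z).im := by
    funext z
    simp [Complex.mul_im]; ring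
  rw [e] at key
  refine key.congr (Eventually.of_forall fun z => ?_)
  simp only [Complex.sq_norm, Complex.normSq_apply, Complex.mul_im, Complex.mul_re, Complex.add_re,
    Complex.add_im, Complex.sub_re, Complex.sub_im, Complex.conj_re, Complex.conj_im]
  ring

end IsSolution


theorem IsACPrimitive.of_absolutelyContinuous_real {F : ℝ → ℝ}
    (hF : ∀ a b, AbsolutelyContinuousOnInterval F a b) : IsACPrimitive F (deriv F) := by
  refine ⟨hF, ?_⟩
  have : ∀ᵐ x : ℝ, ∀ n : ℕ, x ∈ uIcc (-n : ℝ) n → DifferentiableAt ℝ F x :=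
    ae_all_iff.2 fun n => (hF (-n) n).ae_differentiableAt
  filter_upwards [this] with x hx
  obtain ⟨n, hn⟩ := exists_nat_ge |x|
  refine (hx n ?_).hasDerivAt
  rw [uIcc_of_le (by simp)]
  exact abs_le.1 hn

/-- Almost everywhere differentiability is taken from the real and imaginary parts. -/
theorem IsACPrimitive.of_absolutelyContinuous {F : ℝ → ℂ}
    (hF : ∀ a b, AbsolutelyContinuousOnInterval F a b) : IsACPrimitive F (deriv F) := by
  have hlip : ∀ L : ℂ →L[ℝ] ℝ, ∀ a b, AbsolutelyContinuousOnInterval (fun x => L (F x)) a b := by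
    intro L a b
    have h := Tendsto.const_mul ‖L‖ (hF a b)
    rw [mul_zero] at h
    refine squeeze_zero (fun t => Finset.sum_nonneg fun i _ => dist_nonneg) (fun t => ?_) h
    rw [Finset.mul_sum]
    refine Finset.sum_le_sum fun i _ => ?_
    rw [dist_eq_norm, dist_eq_norm, ← map_sub]
    exact L.le_opNorm _
  refine ⟨hF, ?_⟩
  have h1 := (of_absolutelyContinuous_real (hlip Complex.reCLM)).ofReal.hasDerivAt
  have h2 := (of_absolutelyContinuous_real (hlip Complex.imCLM)).ofReal.hasDerivAt
  filter_upwards [h1, h2] with x hx1 hx2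
  have := hx1.add (hx2.mul_const Complex.I)
  refine DifferentiableAt.hasDerivAt (this.differentiableAt.congr_of_eventuallyEq ?_)
  exact Eventually.of_forall fun z => (Complex.re_add_im (F z)).symm

/-- The canonical potential with entries `p` and `q`. -/
def canonicalPotential (p q : ℝ → ℝ) (z : ℝ) : Matrix (Fin 2) (Fin 2) ℂ :=
  !![(p z : ℂ), q z; q z, -p z]

theorem canonical_equation_iff {D Y : Matrix (Fin 2) (Fin 2) ℂ} {z : ℝ} :
    J * D + canonicalPotential p q z * Y = l • Y ↔
      ∀ j, D 0 j = q z * Y 0 j - (p z + l) * Y 1 j ∧ D 1 j = (l - p z) * Y 0 j - q z * Y 1 j := by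
  have h0 : ∀ j, (J * D + canonicalPotential p q z * Y) 0 j =
      D 1 j + (p z * Y 0 j + q z * Y 1 j) := fun j => by
    rw [Matrix.add_apply, Matrix.mul_apply, Matrix.mul_apply, Fin.sum_univ_two, Fin.sum_univ_two]
    simp [J, canonicalPotential]
  have h1 : ∀ j, (J * D + canonicalPotential p q z * Y) 1 j =
      -D 0 j + (q z * Y 0 j - p z * Y 1 j) := fun j => by
    rw [Matrix.add_apply, Matrix.mul_apply, Matrix.mul_apply, Fin.sum_univ_two, Fin.sum_univ_two]
    simp [J, canonicalPotential]
    ring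
  constructor
  · intro h j
    have e0 := h0 j
    have e1 := h1 j
    rw [h, Matrix.smul_apply, smul_eq_mul] at e0 e1
    exact ⟨by linear_combination e1, by linear_combination -e0⟩
  · intro h
    ext i j
    fin_cases i
    · refine (h0 j).trans ?_
      rw [(h j).2]
      simp
      ring
    · refine (h1 j).trans ?_
      rw [(h j).1]
      simp
      ring

theorem isFundamentalMatrix_iff {Y : ℝ → Matrix (Fin 2) (Fin 2) ℂ} :
    IsFundamentalMatrix (canonicalPotential p q) l Y ↔
      (∀ j, IsSolution p q l (fun z => Y z 0 j) (fun z => Y z 1 j)) ∧ Y 0 = 1 := by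
  constructor
  · intro h
    have key : ∀ j, ∀ᵐ z, deriv (fun t => Y t 0 j) z =
        q z * Y z 0 j - (p z + l) * Y z 1 j ∧ deriv (fun t => Y t 1 j) z =
        (l - p z) * Y z 0 j - q z * Y z 1 j := by
      intro j
      filter_upwards [h.ode] with z hz using canonical_equation_iff.1 hz j
    refine ⟨fun j => ⟨?_, ?_⟩, h.init⟩
    · exact (IsACPrimitive.of_absolutelyContinuous (h.absCont 0 j)).congr
        (by filter_upwards [key j] with z hz using hz.1)
    · exact (IsACPrimitive.of_absolutelyContinuous (h.absCont 1 j)).congr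
        (by filter_upwards [key j] with z hz using hz.2)
  · rintro ⟨h, h0⟩
    refine ⟨fun i j a b => ?_, ?_, h0⟩
    · fin_cases i
      · exact (h j).fst.ac a b
      · exact (h j).snd.ac a b
    · filter_upwards [(h 0).fst.hasDerivAt, (h 1).fst.hasDerivAt, (h 0).snd.hasDerivAt,
        (h 1).snd.hasDerivAt] with z h1 h2 h3 h4
      refine canonical_equation_iff.2 fun j => ?_
      fin_cases j
      · exact ⟨h1.deriv, h3.deriv⟩
      · exact ⟨h2.deriv, h4.deriv⟩

/-- Both entries of the potential are locally integrable. -/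
structure LocallyIntegrableEntries (p q : ℝ → ℝ) : Prop where
  left : ∀ a b, IntervalIntegrable p volume a b
  right : ∀ a b, IntervalIntegrable q volume a b

namespace LocallyIntegrableEntries

variable (h : LocallyIntegrableEntries p q)
include h

theorem shift (t : ℝ) : LocallyIntegrableEntries (fun z => p (z + t)) (fun z => q (z + t)) :=
  ⟨fun a b => by simpa using (h.left (a + t) (b + t)).comp_add_right t,
    fun a b => by simpa using (h.right (a + t) (b + t)).comp_add_right t⟩

end LocallyIntegrableEntries

/-- The fundamental matrix of the canonical system with entries `p` and `q`. -/
noncomputable abbrev fundMat (p q : ℝ → ℝ) (l : ℂ) (z : ℝ) : Matrix (Fin 2) (Fin 2) ℂ :=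
  fundamentalMatrix (canonicalPotential p q) l z

namespace LocallyIntegrableEntries

theorem isFundamentalMatrix (h : LocallyIntegrableEntries p q) (l : ℂ) :
    IsFundamentalMatrix (canonicalPotential p q) l (fundMat p q l) := by
  obtain ⟨u, v, huv, hu, hv⟩ := exists_isSolution h.left h.right l 1 0
  obtain ⟨u', v', huv', hu', hv'⟩ := exists_isSolution h.left h.right l 0 1
  have hex : ∃ Y, IsFundamentalMatrix (canonicalPotential p q) l Y := by
    refine ⟨fun z => !![u z, u' z; v z, v' z], isFundamentalMatrix_iff.2 ⟨fun j => ?_, ?_⟩⟩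
    · fin_cases j
      · exact huv
      · exact huv'
    · rw [hu, hv, hu', hv', Matrix.one_fin_two]
  have e : fundMat p q l = hex.choose := by
    funext z
    simp only [fundMat, fundamentalMatrix, dif_pos hex]
  rw [e]
  exact hex.choose_spec

theorem isSolution (h : LocallyIntegrableEntries p q) (l : ℂ) (j : Fin 2) :
    IsSolution p q l (fun z => fundMat p q l z 0 j) (fun z => fundMat p q l z 1 j) :=
  (isFundamentalMatrix_iff.1 (h.isFundamentalMatrix l)).1 j

theorem fundMat_zero (h : LocallyIntegrableEntries p q) (l : ℂ) : fundMat p q l 0 = 1 :=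
  (h.isFundamentalMatrix l).init

theorem det_fundMat (h : LocallyIntegrableEntries p q) (l : ℂ) (z : ℝ) :
    (fundMat p q l z).det = 1 := by
  have := (h.isSolution l 0).wronskian_eq (h.isSolution l 1) z
  rw [h.fundMat_zero] at this
  rw [Matrix.det_fin_two]
  simp at this
  linear_combination this

/-- Solutions are determined by their initial values. -/
theorem eq_fundMat (h : LocallyIntegrableEntries p q) (huv : IsSolution p q l u v) (z : ℝ) :
    u z = fundMat p q l z 0 0 * u 0 + fundMat p q l z 0 1 * v 0 ∧
      v z = fundMat p q l z 1 0 * u 0 + fundMat p q l z 1 1 * v 0 := by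
  -- Uniqueness comes from Cramer's rule: the Wronskians of the solution with both columns are
  -- constant, and the columns have determinant 1.
  have h0 := (h.isSolution l 0).wronskian_eq huv z
  have h1 := (h.isSolution l 1).wronskian_eq huv z
  have hd := h.det_fundMat l z
  rw [h.fundMat_zero] at h0 h1
  rw [Matrix.det_fin_two] at hd
  simp at h0 h1
  constructor
  · linear_combination (-u z) * hd + fundMat p q l z 0 1 * h0 - fundMat p q l z 0 0 * h1
  · linear_combination (-v z) * hd + fundMat p q l z 1 1 * h0 - fundMat p q l z 1 0 * h1

theorem mul_fundMat (h : LocallyIntegrableEntries p q) {Y : ℝ → Matrix (Fin 2) (Fin 2) ℂ}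
    (hY : ∀ j, IsSolution p q l (fun z => Y z 0 j) (fun z => Y z 1 j)) (z : ℝ) :
    Y z = fundMat p q l z * Y 0 := by
  ext i j
  have := h.eq_fundMat (hY j) z
  fin_cases i
  · simpa [Matrix.mul_apply, Fin.sum_univ_two] using this.1
  · simpa [Matrix.mul_apply, Fin.sum_univ_two] using this.2

/-- The cocycle property of fundamental matrices. -/
theorem fundMat_add (h : LocallyIntegrableEntries p q) (l : ℂ) (t z : ℝ) :
    fundMat p q l (z + t) =
      fundMat (fun z => p (z + t)) (fun z => q (z + t)) l z * fundMat p q l t := by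
  have := (h.shift t).mul_fundMat (Y := fun z => fundMat p q l (z + t))
    (fun j => (h.isSolution l j).shift t) z
  simpa using this

theorem fundMat_conj (h : LocallyIntegrableEntries p q) (l : ℂ) (z : ℝ) :
    fundMat p q (starRingEnd ℂ l) z = (fundMat p q l z).map (starRingEnd ℂ) := by
  have := h.mul_fundMat (Y := fun z => (fundMat p q l z).map (starRingEnd ℂ))
    (fun j => (h.isSolution l j).conj) z
  rw [this, h.fundMat_zero, Matrix.map_one _ (map_zero _) (map_one _), mul_one]

end LocallyIntegrableEntries

end DiracSystem

/-! ### Exponential bounds for solutions -/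

namespace DiracSystem

open Set Filter Topology intervalIntegral Complex

variable {p q : ℝ → ℝ} {l : ℂ} {u v : ℝ → ℂ}

theorem isACPrimitive_cexp (c : ℂ) :
    IsACPrimitive (fun z : ℝ => cexp (c * z)) (fun z => c * cexp (c * z)) := by
  have h : ∀ z : ℝ, HasDerivAt (fun z : ℝ => cexp (c * z)) (c * cexp (c * z)) z := fun z => by
    have := ((hasDerivAt_id z).ofReal_comp.const_mul c).cexp
    simpa [mul_comm] using this
  refine (IsACPrimitive.of_contDiff ?_).congr (Eventually.of_forall fun z => (h z).deriv)
  exact (contDiff_const.mul ofRealCLM.contDiff).cexp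

theorem norm_cexp_mul_ofReal (c : ℂ) (z : ℝ) : ‖cexp (I * c * z)‖ = Real.exp (-c.im * z) := by
  rw [norm_exp]; simp

namespace LocallyIntegrableEntries

theorem intervalIntegrable_coeff (h : LocallyIntegrableEntries p q) (a b : ℝ) :
    IntervalIntegrable (fun z => (q z : ℂ) + I * p z) volume a b := by
  refine IntervalIntegrable.add ⟨(h.right a b).1.ofReal, (h.right a b).2.ofReal⟩
    (IntervalIntegrable.const_mul ⟨(h.left a b).1.ofReal, (h.left a b).2.ofReal⟩ I)

end LocallyIntegrableEntries

namespace IsSolution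

/-- `u - iv` and `u + iv` are coordinates in the eigenbasis of `J`. The exponential is an
integrating factor that removes `l`; what remains couples each coordinate only to the other. -/
theorem gamma_primitive (h : IsSolution p q l u v) :
    IsACPrimitive (fun z => cexp (I * l * z) * (u z - I * v z))
      (fun z => ((q z : ℂ) + I * p z) * (cexp (I * l * z) * (u z + I * v z))) := by
  refine ((isACPrimitive_cexp (I * l)).mul (h.fst.sub (h.snd.const_mul I))).congr
    (Eventually.of_forall fun z => ?_)
  simp only
  linear_combination (cexp (I * l * z) * (-l * v z - p z * v z)) * I_sq

theorem delta_primitive (h : IsSolution p q l u v) :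
    IsACPrimitive (fun z => cexp (I * (-l) * z) * (u z + I * v z))
      (fun z => ((q z : ℂ) - I * p z) * (cexp (I * (-l) * z) * (u z - I * v z))) := by
  refine ((isACPrimitive_cexp (I * (-l))).mul (h.fst.add (h.snd.const_mul I))).congr
    (Eventually.of_forall fun z => ?_)
  simp only
  linear_combination (cexp (I * (-l) * z) * (-l * v z - p z * v z)) * I_sq

/-- Integrate `delta_primitive`, then switch to the factor `exp(ilz)` that suits `u - iv`; the
mismatch is the kernel `exp(-2 Im l (z - s))`, which decays in the upper half-plane. -/
theorem norm_delta_le (h : IsSolution p q l u v) {z : ℝ} (hz : 0 ≤ z) :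
    ‖cexp (I * l * z) * (u z + I * v z)‖ ≤ Real.exp (-2 * l.im * z) * ‖u 0 + I * v 0‖ +
      ∫ s in (0 : ℝ)..z, ‖(q s : ℂ) + I * p s‖ * Real.exp (-2 * l.im * (z - s)) *
        ‖cexp (I * l * s) * (u s - I * v s)‖ := by
  have h1 := h.delta_primitive.integral 0 z
  have e : cexp (I * l * z) * (u z + I * v z) = cexp (I * (2 * l) * z) * ((u 0 + I * v 0) +
      ∫ s in (0 : ℝ)..z, ((q s : ℂ) - I * p s) * (cexp (I * (-l) * s) * (u s - I * v s))) := by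
    rw [h1]
    simp only [ofReal_zero, mul_zero, Complex.exp_zero, one_mul, add_sub_cancel]
    rw [← mul_assoc, ← Complex.exp_add]
    ring_nf
  have e2 : Real.exp (-(2 * l).im * z) = Real.exp (-2 * l.im * z) := by
    congr 1; simp
  rw [e, norm_mul, norm_cexp_mul_ofReal, e2]
  have h2 := intervalIntegral.norm_integral_le_integral_norm (μ := volume) hz
    (f := fun s => ((q s : ℂ) - I * p s) * (cexp (I * (-l) * s) * (u s - I * v s)))
  have h3 : ∫ s in (0 : ℝ)..z, ‖(q s : ℂ) + I * p s‖ * Real.exp (-2 * l.im * (z - s)) *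
        ‖cexp (I * l * s) * (u s - I * v s)‖ = Real.exp (-2 * l.im * z) *
      ∫ s in (0 : ℝ)..z, ‖((q s : ℂ) - I * p s) * (cexp (I * (-l) * s) * (u s - I * v s))‖ := by
    rw [← intervalIntegral.integral_const_mul]
    refine integral_congr fun s _ => ?_
    have hr : ‖(q s : ℂ) - I * p s‖ = ‖(q s : ℂ) + I * p s‖ := by
      rw [← norm_conj ((q s : ℂ) + I * p s)]
      simp [sub_eq_add_neg]
    simp only [norm_mul, norm_cexp_mul_ofReal, hr, neg_im, neg_neg]
    have : Real.exp (-2 * l.im * (z - s)) * Real.exp (-l.im * s) =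
        Real.exp (-2 * l.im * z) * Real.exp (l.im * s) := by
      rw [← Real.exp_add, ← Real.exp_add]; ring_nf
    linear_combination (‖(q s : ℂ) + I * p s‖ * ‖u s - I * v s‖) * this
  rw [h3, ← mul_add]
  refine mul_le_mul_of_nonneg_left ((norm_add_le _ _).trans ?_) (Real.exp_pos _).le
  gcongr

theorem continuous_fst (h : IsSolution p q l u v) : Continuous u := h.fst.continuous
theorem continuous_snd (h : IsSolution p q l u v) : Continuous v := h.snd.continuous

/-- For `Im l ≥ 0` the decaying kernel is at most 1, and Grönwall applies to the sum of the two
coordinates. The bound does not depend on `l`. -/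
theorem norm_gamma_add_norm_delta_le (h : IsSolution p q l u v) (hp : LocallyIntegrableEntries p q)
    (hl : 0 ≤ l.im) {z : ℝ} (hz : 0 ≤ z) :
    ‖cexp (I * l * z) * (u z - I * v z)‖ + ‖cexp (I * l * z) * (u z + I * v z)‖ ≤
      (‖u 0 - I * v 0‖ + ‖u 0 + I * v 0‖) *
        Real.exp (∫ s in (0 : ℝ)..z, ‖(q s : ℂ) + I * p s‖) := by
  have hu := h.continuous_fst
  have hv := h.continuous_snd
  have hk : ∀ a b, IntervalIntegrable (fun s => ‖(q s : ℂ) + I * p s‖) volume a b :=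
    fun a b => (hp.intervalIntegrable_coeff a b).norm
  have hγ : Continuous fun z : ℝ => ‖cexp (I * l * z) * (u z - I * v z)‖ := by fun_prop
  have hδ : Continuous fun z : ℝ => ‖cexp (I * l * z) * (u z + I * v z)‖ := by fun_prop
  refine le_mul_exp_of_le_integral (u := fun z : ℝ => ‖cexp (I * l * z) * (u z - I * v z)‖ +
    ‖cexp (I * l * z) * (u z + I * v z)‖) (L := z) (hγ.add hδ) hk (fun x => norm_nonneg _) ?_
    (right_mem_Icc.2 hz)
  rintro x ⟨hx, -⟩
  have h1 := h.gamma_primitive.integral 0 x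
  have h2 := h.norm_delta_le hx
  have h3 : ‖cexp (I * l * x) * (u x - I * v x)‖ ≤ ‖u 0 - I * v 0‖ +
      ∫ s in (0 : ℝ)..x, ‖(q s : ℂ) + I * p s‖ * ‖cexp (I * l * s) * (u s + I * v s)‖ := by
    have e : cexp (I * l * x) * (u x - I * v x) = (u 0 - I * v 0) +
        ∫ s in (0 : ℝ)..x, ((q s : ℂ) + I * p s) * (cexp (I * l * s) * (u s + I * v s)) := by
      rw [h1]; simp
    rw [e]
    refine (norm_add_le _ _).trans ?_
    refine add_le_add_right ?_ _
    refine (intervalIntegral.norm_integral_le_integral_norm hx).trans (le_of_eq ?_)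
    simp only [norm_mul]
  have h4 : ∫ s in (0 : ℝ)..x, ‖(q s : ℂ) + I * p s‖ * Real.exp (-2 * l.im * (x - s)) *
        ‖cexp (I * l * s) * (u s - I * v s)‖ ≤
      ∫ s in (0 : ℝ)..x, ‖(q s : ℂ) + I * p s‖ * ‖cexp (I * l * s) * (u s - I * v s)‖ := by
    refine integral_mono_on hx ?_ ?_ fun s hs => ?_
    · simp only [mul_assoc]
      exact (hk 0 x).mul_continuousOn (by fun_prop)
    · exact (hk 0 x).mul_continuousOn hγ.continuousOn
    · have : Real.exp (-2 * l.im * (x - s)) ≤ 1 := Real.exp_le_one_iff.2 (by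
        have := mul_nonneg hl (sub_nonneg.2 hs.2)
        linarith)
      have h5 := norm_nonneg ((q s : ℂ) + I * p s)
      exact mul_le_mul_of_nonneg_right (mul_le_of_le_one_right h5 this) (norm_nonneg _)
  have h5 : Real.exp (-2 * l.im * x) * ‖u 0 + I * v 0‖ ≤ ‖u 0 + I * v 0‖ :=
    mul_le_of_le_one_left (norm_nonneg _) (Real.exp_le_one_iff.2 (by
      have := mul_nonneg hl hx
      linarith))
  have h6 : ∫ s in (0 : ℝ)..x, ‖(q s : ℂ) + I * p s‖ *
      (‖cexp (I * l * s) * (u s - I * v s)‖ + ‖cexp (I * l * s) * (u s + I * v s)‖) =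
      (∫ s in (0 : ℝ)..x, ‖(q s : ℂ) + I * p s‖ * ‖cexp (I * l * s) * (u s - I * v s)‖) +
      ∫ s in (0 : ℝ)..x, ‖(q s : ℂ) + I * p s‖ * ‖cexp (I * l * s) * (u s + I * v s)‖ := by
    rw [← intervalIntegral.integral_add ((hk 0 x).mul_continuousOn hγ.continuousOn)
      ((hk 0 x).mul_continuousOn hδ.continuousOn)]
    simp only [mul_add]
  rw [h6]
  linarith

end IsSolution

namespace LocallyIntegrableEntries

theorem norm_fundMat_le (h : LocallyIntegrableEntries p q) (l : ℂ) {z : ℝ} (hz : 0 ≤ z)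
    (i j : Fin 2) : ‖fundMat p q l z i j‖ ≤
      Real.exp (∫ s in (0 : ℝ)..z, ‖(q s : ℂ) + I * p s‖) * Real.exp (|l.im| * z) := by
  -- The coefficients are real, so conjugation exchanges the two half-planes.
  wlog hl : 0 ≤ l.im generalizing l
  · have := this (starRingEnd ℂ l) (by simp; linarith)
    rwa [h.fundMat_conj, Matrix.map_apply, norm_conj, conj_im, abs_neg] at this
  set R := Real.exp (∫ s in (0 : ℝ)..z, ‖(q s : ℂ) + I * p s‖)
  have h1 := (h.isSolution l j).norm_gamma_add_norm_delta_le h hl hz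
  have h0 : ‖fundMat p q l 0 0 j - I * fundMat p q l 0 1 j‖ +
      ‖fundMat p q l 0 0 j + I * fundMat p q l 0 1 j‖ = 2 := by
    rw [h.fundMat_zero]
    rcases (by fin_cases j <;> simp : j = 0 ∨ j = 1) with rfl | rfl <;> simp <;> norm_num
  rw [h0] at h1
  set u := fundMat p q l z 0 j
  set v := fundMat p q l z 1 j
  rw [norm_mul, norm_mul, norm_cexp_mul_ofReal, ← mul_add, neg_mul, Real.exp_neg,
    inv_mul_le_iff₀ (Real.exp_pos _)] at h1
  rw [abs_of_nonneg hl]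
  have hu : ‖u‖ ≤ (‖u - I * v‖ + ‖u + I * v‖) / 2 := by
    have := norm_add_le (u - I * v) (u + I * v)
    have e : u - I * v + (u + I * v) = 2 * u := by ring
    rw [e, norm_mul] at this
    simp at this
    linarith
  have hv : ‖v‖ ≤ (‖u - I * v‖ + ‖u + I * v‖) / 2 := by
    have := norm_sub_le (u + I * v) (u - I * v)
    have e : u + I * v - (u - I * v) = 2 * (I * v) := by ring
    rw [e, norm_mul, norm_mul] at this
    simp at this
    linarith
  fin_cases i
  · change ‖u‖ ≤ _
    linarith
  · change ‖v‖ ≤ _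
    linarith

end LocallyIntegrableEntries

end DiracSystem

/-! ### Asymptotics as `Im l → ∞`, uniformly in `Re l` -/

namespace DiracSystem

open Set Filter Topology intervalIntegral Complex

variable {p q : ℝ → ℝ} {U V : ℂ → ℝ → ℂ} {a b : ℂ}

namespace LocallyIntegrableEntries

theorem eventually_im_nonneg : ∀ᶠ l in comap Complex.im atTop, 0 ≤ l.im :=
  tendsto_comap.eventually (eventually_ge_atTop 0)

theorem tendsto_exp_neg_im {c : ℝ} (hc : 0 < c) :
    Tendsto (fun l : ℂ => Real.exp (-2 * l.im * c)) (comap Complex.im atTop) (𝓝 0) := by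
  refine Real.tendsto_exp_atBot.comp ?_
  have : Tendsto (fun l : ℂ => l.im * (2 * c)) (comap Complex.im atTop) atTop :=
    tendsto_comap.atTop_mul_const (by positivity)
  refine (tendsto_neg_atTop_atBot.comp this).congr fun l => ?_
  simp only [Function.comp]
  ring

/-- Dominated convergence in `norm_delta_le`: the other coordinate is bounded by `C`, and the kernel
tends to 0 for every `s < z`. -/
theorem tendsto_delta (h : LocallyIntegrableEntries p q) (hs : ∀ l, IsSolution p q l (U l) (V l))
    (ha : ∀ l, U l 0 = a) (hb : ∀ l, V l 0 = b) {z : ℝ} (hz : 0 < z) :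
    Tendsto (fun l : ℂ => cexp (I * l * z) * (U l z + I * V l z)) (comap Complex.im atTop)
      (𝓝 0) := by
  set k : ℝ → ℝ := fun s => ‖(q s : ℂ) + I * p s‖ with hk
  have hki : ∀ a b, IntervalIntegrable k volume a b :=
    fun a b => (h.intervalIntegrable_coeff a b).norm
  set C := (‖a - I * b‖ + ‖a + I * b‖) * Real.exp (∫ s in (0 : ℝ)..z, k s)
  have hC : ∀ l : ℂ, 0 ≤ l.im → ∀ s ∈ Icc 0 z, ‖cexp (I * l * s) * (U l s - I * V l s)‖ ≤ C := by
    intro l hl s hsz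
    have h1 := (hs l).norm_gamma_add_norm_delta_le h hl hsz.1
    rw [ha, hb] at h1
    have h2 := norm_nonneg (cexp (I * l * s) * (U l s + I * V l s))
    refine (le_add_of_nonneg_right h2).trans (h1.trans ?_)
    refine mul_le_mul_of_nonneg_left (Real.exp_le_exp.2 ?_) (by positivity)
    exact integral_mono_interval le_rfl hsz.1 hsz.2 (Eventually.of_forall fun _ => norm_nonneg _)
      (hki 0 z)
  rw [tendsto_zero_iff_norm_tendsto_zero]
  have hlim : Tendsto (fun l : ℂ => Real.exp (-2 * l.im * z) * ‖a + I * b‖ +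
      ∫ s in (0 : ℝ)..z, k s * Real.exp (-2 * l.im * (z - s)) * C)
      (comap Complex.im atTop) (𝓝 0) := by
    have h1 := (tendsto_exp_neg_im hz).mul_const ‖a + I * b‖
    have h2 : Tendsto (fun l : ℂ => ∫ s in (0 : ℝ)..z, k s * Real.exp (-2 * l.im * (z - s)) * C)
        (comap Complex.im atTop) (𝓝 (∫ s in (0 : ℝ)..z, 0)) := by
      refine tendsto_integral_filter_of_dominated_convergence (fun s => k s * C) ?_ ?_ ?_ ?_
      · refine Eventually.of_forall fun l => ?_
        have := ((hki 0 z).mul_continuousOn (f := k)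
          (g := fun s => Real.exp (-2 * l.im * (z - s)) * C) (by fun_prop)).1.aestronglyMeasurable
        rw [uIoc_of_le hz.le]
        simpa only [mul_assoc] using this
      · filter_upwards [eventually_im_nonneg] with l hl
        refine Eventually.of_forall fun s hsz => ?_
        rw [uIoc_of_le hz.le] at hsz
        have hC0 : 0 ≤ C := by positivity
        have hk0 : 0 ≤ k s := norm_nonneg _
        rw [Real.norm_of_nonneg (by positivity)]
        have : Real.exp (-2 * l.im * (z - s)) ≤ 1 := Real.exp_le_one_iff.2 (by
          have := mul_nonneg hl (sub_nonneg.2 hsz.2)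
          linarith)
        exact mul_le_mul_of_nonneg_right (mul_le_of_le_one_right hk0 this) hC0
      · exact (hki 0 z).mul_const C
      -- The kernel equals 1 at `s = z`, so this point is discarded.
      · have : ∀ᵐ s : ℝ, s ≠ z := by simp [ae_iff, measure_singleton]
        filter_upwards [this] with s hsz hs'
        rw [uIoc_of_le hz.le] at hs'
        have := ((tendsto_exp_neg_im (sub_pos.2 (lt_of_le_of_ne hs'.2 hsz))).const_mul
          (k s)).mul_const C
        simpa using this
    simpa using h1.add h2
  refine squeeze_zero' (Eventually.of_forall fun _ => norm_nonneg _) ?_ hlim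
  filter_upwards [eventually_im_nonneg] with l hl
  have h1 := (hs l).norm_delta_le hz.le
  rw [ha, hb] at h1
  refine h1.trans (add_le_add_right ?_ _)
  have hu := (hs l).continuous_fst
  have hv := (hs l).continuous_snd
  refine integral_mono_on hz.le ?_ ?_ fun s hsz => ?_
  · simp only [mul_assoc]
    exact (hki 0 z).mul_continuousOn (by fun_prop)
  · simp only [mul_assoc]
    exact (hki 0 z).mul_continuousOn (by fun_prop)
  · exact mul_le_mul_of_nonneg_left (hC l hl s hsz) (by positivity)

/-- This coordinate changes only through its coupling to the one that vanishes by `tendsto_delta`,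
so it keeps its initial value in the limit. -/
theorem tendsto_gamma (h : LocallyIntegrableEntries p q) (hs : ∀ l, IsSolution p q l (U l) (V l))
    (ha : ∀ l, U l 0 = a) (hb : ∀ l, V l 0 = b) {z : ℝ} (hz : 0 < z) :
    Tendsto (fun l : ℂ => cexp (I * l * z) * (U l z - I * V l z)) (comap Complex.im atTop)
      (𝓝 (a - I * b)) := by
  set k : ℝ → ℝ := fun s => ‖(q s : ℂ) + I * p s‖ with hk
  have hki : ∀ a b, IntervalIntegrable k volume a b :=
    fun a b => (h.intervalIntegrable_coeff a b).norm
  set C := (‖a - I * b‖ + ‖a + I * b‖) * Real.exp (∫ s in (0 : ℝ)..z, k s)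
  have hC : ∀ l : ℂ, 0 ≤ l.im → ∀ s ∈ Icc 0 z, ‖cexp (I * l * s) * (U l s + I * V l s)‖ ≤ C := by
    intro l hl s hsz
    have h1 := (hs l).norm_gamma_add_norm_delta_le h hl hsz.1
    rw [ha, hb] at h1
    have h2 := norm_nonneg (cexp (I * l * s) * (U l s - I * V l s))
    refine (le_add_of_nonneg_left h2).trans (h1.trans ?_)
    refine mul_le_mul_of_nonneg_left (Real.exp_le_exp.2 ?_) (by positivity)
    exact integral_mono_interval le_rfl hsz.1 hsz.2 (Eventually.of_forall fun _ => norm_nonneg _)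
      (hki 0 z)
  have e : ∀ l : ℂ, cexp (I * l * z) * (U l z - I * V l z) = (a - I * b) +
      ∫ s in (0 : ℝ)..z, ((q s : ℂ) + I * p s) * (cexp (I * l * s) * (U l s + I * V l s)) := by
    intro l
    rw [(hs l).gamma_primitive.integral 0 z, ha, hb]
    simp
  simp only [e]
  have h2 : Tendsto (fun l : ℂ => ∫ s in (0 : ℝ)..z,
      ((q s : ℂ) + I * p s) * (cexp (I * l * s) * (U l s + I * V l s)))
        (comap Complex.im atTop) (𝓝 (∫ s in (0 : ℝ)..z, 0)) := by
    refine tendsto_integral_filter_of_dominated_convergence (fun s => k s * C) ?_ ?_ ?_ ?_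
    · refine Eventually.of_forall fun l => ?_
      have hu := (hs l).continuous_fst
      have hv := (hs l).continuous_snd
      have := ((h.intervalIntegrable_coeff 0 z).mul_continuousOn
        (g := fun s : ℝ => cexp (I * l * s) * (U l s + I * V l s))
        (by fun_prop)).1.aestronglyMeasurable
      rwa [uIoc_of_le hz.le]
    · filter_upwards [eventually_im_nonneg] with l hl
      refine Eventually.of_forall fun s hsz => ?_
      rw [uIoc_of_le hz.le] at hsz
      rw [norm_mul]
      exact mul_le_mul_of_nonneg_left (hC l hl s (Ioc_subset_Icc_self hsz)) (norm_nonneg _)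
    · exact (hki 0 z).mul_const C
    · refine Eventually.of_forall fun s hs' => ?_
      rw [uIoc_of_le hz.le] at hs'
      simpa using (h.tendsto_delta hs ha hb hs'.1).const_mul ((q s : ℂ) + I * p s)
  simpa using h2.const_add (a - I * b)

end LocallyIntegrableEntries

/-- The spectral projection of `J` for the eigenvalue `I`. -/
noncomputable def projPlus : Matrix (Fin 2) (Fin 2) ℂ := !![1 / 2, -I / 2; I / 2, 1 / 2]

/-- High energy asymptotics of the fundamental matrix. -/
theorem LocallyIntegrableEntries.tendsto_fundMat (h : LocallyIntegrableEntries p q) {z : ℝ}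
    (hz : 0 < z) (i j : Fin 2) :
    Tendsto (fun l : ℂ => cexp (I * l * z) * fundMat p q l z i j) (comap Complex.im atTop)
      (𝓝 (projPlus i j)) := by
  have key : ∀ (a b : ℂ) (j : Fin 2), (∀ l, fundMat p q l 0 0 j = a) →
      (∀ l, fundMat p q l 0 1 j = b) →
      Tendsto (fun l : ℂ => cexp (I * l * z) * fundMat p q l z 0 j) (comap Complex.im atTop)
        (𝓝 ((a - I * b) / 2)) ∧
      Tendsto (fun l : ℂ => cexp (I * l * z) * fundMat p q l z 1 j) (comap Complex.im atTop)
        (𝓝 (I * (a - I * b) / 2)) := by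
    intro a b j ha hb
    have h1 := h.tendsto_gamma (fun l => h.isSolution l j) ha hb hz
    have h2 := h.tendsto_delta (fun l => h.isSolution l j) ha hb hz
    constructor
    · refine (((h1.add h2).div_const 2).congr fun l => ?_).trans (le_of_eq ?_)
      · ring
      · simp
    · refine (((h1.sub h2).const_mul (I / 2)).congr fun l => ?_).trans (le_of_eq ?_)
      · linear_combination (-cexp (I * l * z) * fundMat p q l z 1 j) * I_sq
      · simp; ring_nf
  have e0 := key 1 0 0 (fun l => by simp [h.fundMat_zero]) (fun l => by simp [h.fundMat_zero])
  have e1 := key 0 1 1 (fun l => by simp [h.fundMat_zero]) (fun l => by simp [h.fundMat_zero])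
  fin_cases i <;> fin_cases j
  · simpa [projPlus] using e0.1
  · simpa [projPlus] using e1.1
  · simpa [projPlus] using e0.2
  · simpa [projPlus] using e1.2

end DiracSystem

/-! ### Analytic dependence on the spectral parameter -/

namespace DiracSystem

open Set Filter Topology intervalIntegral Complex

variable {p q : ℝ → ℝ}

/-- The Gram matrix `∫₀ᶻ Y(s, l)ᵀ Y(s, m) ds` of the fundamental matrices. -/
noncomputable def gram (p q : ℝ → ℝ) (l m : ℂ) (z : ℝ) : Matrix (Fin 2) (Fin 2) ℂ :=
  Matrix.of fun i j => ∫ s in (0 : ℝ)..z,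
    (fundMat p q l s 0 i * fundMat p q m s 0 j + fundMat p q l s 1 i * fundMat p q m s 1 j)

namespace LocallyIntegrableEntries

theorem continuous_fundMat (h : LocallyIntegrableEntries p q) (l : ℂ) (i j : Fin 2) :
    Continuous fun z => fundMat p q l z i j := by
  fin_cases i
  · exact (h.isSolution l j).continuous_fst
  · exact (h.isSolution l j).continuous_snd

/-- Lagrange's identity in matrix form is `Y(l)ᵀ J Y(m) = J + (m - l) G`; unimodularity gives
`Y(l)⁻¹ = -J Y(l)ᵀ J`. The exact factor `m - l` yields first continuity and then the derivative in
`m`. -/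
theorem fundMat_eq_mul_gram (h : LocallyIntegrableEntries p q) (l m : ℂ) (z : ℝ) :
    fundMat p q m z = fundMat p q l z * (1 - (m - l) • (J * gram p q l m z)) := by
  have hJ : ∀ i j, J i j = (1 : Matrix (Fin 2) (Fin 2) ℂ) 0 i *
      (1 : Matrix (Fin 2) (Fin 2) ℂ) 1 j - (1 : Matrix (Fin 2) (Fin 2) ℂ) 1 i *
      (1 : Matrix (Fin 2) (Fin 2) ℂ) 0 j := by
    simp [Fin.forall_fin_two, J]
  have key : ∀ i j, fundMat p q l z 0 i * fundMat p q m z 1 j -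
      fundMat p q l z 1 i * fundMat p q m z 0 j - J i j = (m - l) * gram p q l m z i j := by
    intro i j
    have := ((h.isSolution l i).lagrange (h.isSolution m j)).integral 0 z
    rw [intervalIntegral.integral_const_mul] at this
    rw [gram, Matrix.of_apply, this, h.fundMat_zero, h.fundMat_zero]
    rw [hJ i j]
  have hd := h.det_fundMat l z
  rw [Matrix.det_fin_two] at hd
  have k00 := key 0 0
  have k01 := key 0 1
  have k10 := key 1 0
  have k11 := key 1 1
  simp [J] at k00 k01 k10 k11
  have e : (1 - (m - l) • (J * gram p q l m z) : Matrix (Fin 2) (Fin 2) ℂ) =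
      !![1 - (m - l) * gram p q l m z 1 0, -((m - l) * gram p q l m z 1 1);
        (m - l) * gram p q l m z 0 0, 1 + (m - l) * gram p q l m z 0 1] := by
    ext i j
    rw [Matrix.sub_apply, Matrix.smul_apply, Matrix.mul_apply, Fin.sum_univ_two]
    fin_cases i <;> fin_cases j <;> simp [J]
  rw [e, ← k00, ← k01, ← k10, ← k11]
  ext i j
  rw [Matrix.mul_apply, Fin.sum_univ_two]
  fin_cases i <;> fin_cases j <;> simp
  · linear_combination (-fundMat p q m z 0 0) * hd
  · linear_combination (-fundMat p q m z 0 1) * hd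
  · linear_combination (-fundMat p q m z 1 0) * hd
  · linear_combination (-fundMat p q m z 1 1) * hd

theorem exists_bound_fundMat (h : LocallyIntegrableEntries p q) (l : ℂ) (z : ℝ) :
    ∃ B, 0 ≤ B ∧ ∀ m ∈ Metric.ball l 1, ∀ s ∈ Icc 0 z, ∀ i j, ‖fundMat p q m s i j‖ ≤ B := by
  refine ⟨Real.exp (∫ s in (0 : ℝ)..z, ‖(q s : ℂ) + I * p s‖) * Real.exp ((|l.im| + 1) * z),
    by positivity, fun m hm s hs i j => (h.norm_fundMat_le m hs.1 i j).trans ?_⟩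
  have hm' : |m.im| ≤ |l.im| + 1 := by
    have h1 : |m.im - l.im| ≤ 1 := by
      rw [← sub_im]
      exact (abs_im_le_norm _).trans (by rw [← dist_eq_norm]; exact (Metric.mem_ball.1 hm).le)
    have := abs_sub_abs_le_abs_sub m.im l.im
    linarith
  gcongr
  · exact integral_mono_interval le_rfl hs.1 hs.2 (Eventually.of_forall fun _ => norm_nonneg _)
      (h.intervalIntegrable_coeff 0 z).norm
  · exact hs.1
  · exact hs.2

/-- The increment is `m - l` times a quantity bounded for `m` near `l`. -/
theorem continuousAt_fundMat (h : LocallyIntegrableEntries p q) (l : ℂ) {z : ℝ} (hz : 0 ≤ z)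
    (i j : Fin 2) : ContinuousAt (fun m => fundMat p q m z i j) l := by
  obtain ⟨B, hB0, hB⟩ := h.exists_bound_fundMat l z
  have hG : ∀ m ∈ Metric.ball l 1, ∀ i j, ‖gram p q l m z i j‖ ≤ (B * B + B * B) * |z - 0| := by
    intro m hm i j
    refine norm_integral_le_of_norm_le_const fun s hs => ?_
    rw [uIoc_of_le hz] at hs
    have hs' := Ioc_subset_Icc_self hs
    have hl := Metric.mem_ball_self (x := l) one_pos
    refine (norm_add_le _ _).trans ?_
    rw [norm_mul, norm_mul]
    gcongr <;> first | exact hB _ hl _ hs' _ _ | exact hB _ hm _ hs' _ _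
  have hent : ∀ m, fundMat p q m z i j = fundMat p q l z i j - (m - l) *
      (fundMat p q l z i 0 * gram p q l m z 1 j - fundMat p q l z i 1 * gram p q l m z 0 j) := by
    intro m
    rw [h.fundMat_eq_mul_gram l m z, mul_sub, mul_one, Matrix.mul_smul, Matrix.sub_apply,
      Matrix.smul_apply, Matrix.mul_apply, Fin.sum_univ_two, Matrix.mul_apply, Fin.sum_univ_two,
      Matrix.mul_apply, Fin.sum_univ_two]
    simp [J]
    left
    ring
  have h0 : Tendsto (fun m => (m - l) * (fundMat p q l z i 0 * gram p q l m z 1 j -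
      fundMat p q l z i 1 * gram p q l m z 0 j)) (𝓝 l) (𝓝 0) := by
    refine Tendsto.zero_mul_isBoundedUnder_le ?_ ?_
    · have : Continuous fun m : ℂ => m - l := by fun_prop
      simpa using this.tendsto l
    · refine ⟨B * ((B * B + B * B) * |z - 0|) + B * ((B * B + B * B) * |z - 0|), ?_⟩
      rw [eventually_map]
      filter_upwards [Metric.ball_mem_nhds l one_pos] with m hm
      refine (norm_sub_le _ _).trans ?_
      rw [norm_mul, norm_mul]
      have hl := Metric.mem_ball_self (x := l) one_pos
      gcongr <;> first | exact hB _ hl _ (right_mem_Icc.2 hz) _ _ | exact hG m hm _ _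
  have := h0.const_sub (fundMat p q l z i j)
  rw [sub_zero] at this
  exact this.congr fun m => (hent m).symm

theorem continuousAt_gram (h : LocallyIntegrableEntries p q) (l : ℂ) {z : ℝ} (hz : 0 ≤ z)
    (i j : Fin 2) : ContinuousAt (fun m => gram p q l m z i j) l := by
  obtain ⟨B, hB0, hB⟩ := h.exists_bound_fundMat l z
  refine tendsto_integral_filter_of_dominated_convergence (fun _ => B * B + B * B) ?_ ?_ ?_ ?_
  · refine Eventually.of_forall fun m => Continuous.aestronglyMeasurable ?_
    have h1 := h.continuous_fundMat l
    have h2 := h.continuous_fundMat m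
    exact ((h1 _ _).mul (h2 _ _)).add ((h1 _ _).mul (h2 _ _))
  · filter_upwards [Metric.ball_mem_nhds l one_pos] with m hm
    refine Eventually.of_forall fun s hs => ?_
    rw [uIoc_of_le hz] at hs
    have hs' := Ioc_subset_Icc_self hs
    have hl := Metric.mem_ball_self (x := l) one_pos
    refine (norm_add_le _ _).trans ?_
    rw [norm_mul, norm_mul]
    gcongr <;> first | exact hB _ hl _ hs' _ _ | exact hB _ hm _ hs' _ _
  · exact intervalIntegrable_const
  · refine Eventually.of_forall fun s hs => ?_
    rw [uIoc_of_le hz] at hs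
    exact ((h.continuousAt_fundMat l hs.1.le 0 j).const_mul _).add
      ((h.continuousAt_fundMat l hs.1.le 1 j).const_mul _)

/-- The derivative of the fundamental matrix with respect to the spectral parameter. -/
theorem hasDerivAt_fundMat (h : LocallyIntegrableEntries p q) (l : ℂ) {z : ℝ} (hz : 0 ≤ z)
    (i j : Fin 2) : HasDerivAt (fun m => fundMat p q m z i j)
      (-(fundMat p q l z * J * gram p q l l z) i j) l := by
  have hent : ∀ m, fundMat p q m z i j = fundMat p q l z i j - (m - l) *
      (fundMat p q l z * J * gram p q l m z) i j := by
    intro m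
    conv_lhs => rw [h.fundMat_eq_mul_gram l m z, mul_sub, mul_one, Matrix.mul_smul,
      Matrix.sub_apply, Matrix.smul_apply, ← mul_assoc, smul_eq_mul]
  rw [hasDerivAt_iff_tendsto_slope]
  have hc : ContinuousAt (fun m => -(fundMat p q l z * J * gram p q l m z) i j) l := by
    simp only [Matrix.mul_apply (M := fundMat p q l z * J), Fin.sum_univ_two]
    exact (((h.continuousAt_gram l hz 0 j).const_mul _).add
      ((h.continuousAt_gram l hz 1 j).const_mul _)).neg
  refine (hc.tendsto.mono_left nhdsWithin_le_nhds).congr' ?_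
  filter_upwards [self_mem_nhdsWithin] with m hm
  rw [slope_def_field, hent m]
  have : m - l ≠ 0 := sub_ne_zero.2 hm
  field_simp
  ring

theorem differentiable_fundMat (h : LocallyIntegrableEntries p q) {z : ℝ} (hz : 0 ≤ z)
    (i j : Fin 2) : Differentiable ℂ fun m => fundMat p q m z i j :=
  fun l => (h.hasDerivAt_fundMat l hz i j).differentiableAt

end LocallyIntegrableEntries

end DiracSystem

/-! ### Lower bounds for `Δ + 2σ` -/

namespace DiracSystem

open Set Filter Topology intervalIntegral Complex

variable {p q : ℝ → ℝ}

/-- Test the bound on the columns of the adjugate, which `N` maps to `det N` times basis vectors,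
and on the first basis vector. This yields `ρ² ≤ 2 |det N|²`. -/
theorem sq_le_norm_det {N : Matrix (Fin 2) (Fin 2) ℂ} {ρ : ℝ} (hρ : 0 ≤ ρ)
    (hN : ∀ a b : ℂ, ρ * (‖a‖ ^ 2 + ‖b‖ ^ 2) ≤
      ‖N 0 0 * a + N 0 1 * b‖ ^ 2 + ‖N 1 0 * a + N 1 1 * b‖ ^ 2) : ρ / 2 ≤ ‖N.det‖ := by
  have h1 := hN 1 0
  have h2 := hN (N 1 1) (-N 1 0)
  have h3 := hN (-N 0 1) (N 0 0)
  have e1 : N 0 0 * N 1 1 + N 0 1 * -N 1 0 = N.det := by rw [Matrix.det_fin_two]; ring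
  have e2 : N 1 0 * N 1 1 + N 1 1 * -N 1 0 = 0 := by ring
  have e3 : N 0 0 * -N 0 1 + N 0 1 * N 0 0 = 0 := by ring
  have e4 : N 1 0 * -N 0 1 + N 1 1 * N 0 0 = N.det := by rw [Matrix.det_fin_two]; ring
  rw [e1, e2] at h2
  rw [e3, e4] at h3
  simp at h1 h2 h3
  refine le_of_sq_le_sq ?_ (norm_nonneg _)
  have h4 := mul_le_mul_of_nonneg_left h1 hρ
  have h5 := mul_nonneg hρ (sq_nonneg ‖N 1 1‖)
  have h6 := mul_nonneg hρ (sq_nonneg ‖N 0 1‖)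
  nlinarith [mul_nonneg hρ hρ]

namespace LocallyIntegrableEntries

/-- If `w = (Y(L) + σ)(a, b)` is small, the solution is nearly (anti)periodic, so the boundary terms
of the energy identity nearly cancel; but they equal `Im l` times the squared `L²` norm.
Unimodularity bounds `Y⁻¹` by the same `B`, whence the constant `L / (4 B²)`. -/
theorem energy_lower_bound (h : LocallyIntegrableEntries p q) {L : ℝ} (hL : 0 ≤ L) {l : ℂ} {B : ℝ}
    (hB0 : 0 < B) (hB : ∀ s ∈ Icc 0 L, ∀ i j, ‖fundMat p q l s i j‖ ≤ B) {σ : ℝ} (hσ : σ ^ 2 = 1)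
    (a b : ℂ) :
    L / (4 * B ^ 2) * |l.im| * (‖a‖ ^ 2 + ‖b‖ ^ 2) ≤
      ‖(fundMat p q l L 0 0 + σ) * a + fundMat p q l L 0 1 * b‖ *
          ‖fundMat p q l L 1 0 * a + (fundMat p q l L 1 1 + σ) * b‖ +
        (‖(fundMat p q l L 0 0 + σ) * a + fundMat p q l L 0 1 * b‖ * ‖b‖ +
          ‖a‖ * ‖fundMat p q l L 1 0 * a + (fundMat p q l L 1 1 + σ) * b‖) := by
  set U : ℝ → ℂ := fun z => a * fundMat p q l z 0 0 + b * fundMat p q l z 0 1 with hU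
  set V : ℝ → ℂ := fun z => a * fundMat p q l z 1 0 + b * fundMat p q l z 1 1 with hV
  have hs : IsSolution p q l U V := (h.isSolution l 0).linear_comb (h.isSolution l 1) a b
  have hUc := hs.continuous_fst
  have hVc := hs.continuous_snd
  have hU0 : U 0 = a := by simp [hU, h.fundMat_zero]
  have hV0 : V 0 = b := by simp [hV, h.fundMat_zero]
  have hE := hs.energy.integral_real 0 L
  rw [intervalIntegral.integral_const_mul, hU0, hV0] at hE
  have hlow : L / (4 * B ^ 2) * (‖a‖ ^ 2 + ‖b‖ ^ 2) ≤
      ∫ s in (0 : ℝ)..L, (‖U s‖ ^ 2 + ‖V s‖ ^ 2) := by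
    have hpt : ∀ s ∈ Icc 0 L, (‖a‖ ^ 2 + ‖b‖ ^ 2) / (4 * B ^ 2) ≤ ‖U s‖ ^ 2 + ‖V s‖ ^ 2 := by
      intro s hs
      have hd := h.det_fundMat l s
      rw [Matrix.det_fin_two] at hd
      have ea : a = fundMat p q l s 1 1 * U s - fundMat p q l s 0 1 * V s := by
        simp only [hU, hV]; linear_combination (-a) * hd
      have eb : b = fundMat p q l s 0 0 * V s - fundMat p q l s 1 0 * U s := by
        simp only [hU, hV]; linear_combination (-b) * hd
      have ha : ‖a‖ ≤ B * ‖U s‖ + B * ‖V s‖ := by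
        rw [ea]
        refine (norm_sub_le _ _).trans ?_
        rw [norm_mul, norm_mul]
        gcongr <;> exact hB s hs _ _
      have hb : ‖b‖ ≤ B * ‖V s‖ + B * ‖U s‖ := by
        rw [eb]
        refine (norm_sub_le _ _).trans ?_
        rw [norm_mul, norm_mul]
        gcongr <;> exact hB s hs _ _
      rw [div_le_iff₀ (by positivity)]
      have h1 : ‖a‖ ^ 2 ≤ (B * ‖U s‖ + B * ‖V s‖) ^ 2 := by gcongr
      have h2 : ‖b‖ ^ 2 ≤ (B * ‖V s‖ + B * ‖U s‖) ^ 2 := by gcongr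
      nlinarith [sq_nonneg (B * ‖U s‖ - B * ‖V s‖)]
    have := integral_mono_on (f := fun _ => (‖a‖ ^ 2 + ‖b‖ ^ 2) / (4 * B ^ 2))
      (g := fun s => ‖U s‖ ^ 2 + ‖V s‖ ^ 2) (μ := volume) hL intervalIntegrable_const
      (Continuous.intervalIntegrable (by fun_prop) _ _) hpt
    rw [intervalIntegral.integral_const, smul_eq_mul, sub_zero] at this
    refine (le_of_eq ?_).trans this
    ring
  set w₁ := (fundMat p q l L 0 0 + σ) * a + fundMat p q l L 0 1 * b
  set w₂ := fundMat p q l L 1 0 * a + (fundMat p q l L 1 1 + σ) * b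
  have hUL : U L = w₁ - σ * a := by simp only [hU, w₁]; ring
  have hVL : V L = w₂ - σ * b := by simp only [hV, w₂]; ring
  have hσ' : (σ : ℂ) ^ 2 = 1 := by exact_mod_cast hσ
  have hdiff : (starRingEnd ℂ (U L) * V L).im - (starRingEnd ℂ a * b).im =
      (starRingEnd ℂ w₁ * w₂ - σ * (starRingEnd ℂ w₁ * b + starRingEnd ℂ a * w₂)).im := by
    rw [← sub_im]
    congr 1
    rw [hUL, hVL]
    simp only [map_sub, map_mul, conj_ofReal]
    linear_combination (starRingEnd ℂ a * b) * hσ'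
  have hσn : ‖(σ : ℂ)‖ = 1 := by
    rw [norm_real, Real.norm_eq_abs, ← sq_eq_sq₀ (abs_nonneg _) zero_le_one, sq_abs, hσ, one_pow]
  calc L / (4 * B ^ 2) * |l.im| * (‖a‖ ^ 2 + ‖b‖ ^ 2)
      = |l.im| * (L / (4 * B ^ 2) * (‖a‖ ^ 2 + ‖b‖ ^ 2)) := by ring
    _ ≤ |l.im| * ∫ s in (0 : ℝ)..L, (‖U s‖ ^ 2 + ‖V s‖ ^ 2) := by gcongr
    _ = |l.im * ∫ s in (0 : ℝ)..L, (‖U s‖ ^ 2 + ‖V s‖ ^ 2)| := by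
        rw [abs_mul, abs_of_nonneg (a := ∫ s in (0 : ℝ)..L, (‖U s‖ ^ 2 + ‖V s‖ ^ 2))]
        exact integral_nonneg hL fun s _ => by positivity
    _ ≤ ‖starRingEnd ℂ w₁ * w₂ - σ * (starRingEnd ℂ w₁ * b + starRingEnd ℂ a * w₂)‖ := by
        rw [hE, hdiff]; exact abs_im_le_norm _
    _ ≤ ‖w₁‖ * ‖w₂‖ + (‖w₁‖ * ‖b‖ + ‖a‖ * ‖w₂‖) := by
        refine (norm_sub_le _ _).trans ?_
        rw [norm_mul, norm_mul, norm_conj, hσn, one_mul]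
        refine add_le_add_right ((norm_add_le _ _).trans ?_) _
        rw [norm_mul, norm_mul, norm_conj, norm_conj]

/-- Since `det Y = 1` and `σ² = 1`, `det (Y + σ) = σ (tr Y + 2σ)`; the energy bound says that `Y +
σ` is bounded below off the real axis. -/
theorem exists_det_lower_bound (h : LocallyIntegrableEntries p q) {L : ℝ} (hL : 0 < L) {σ : ℝ}
    (hσ : σ ^ 2 = 1) (T : ℝ) : ∃ c, 0 < c ∧ ∀ l : ℂ, |l.im| ≤ T →
      c * l.im ^ 2 ≤ ‖(fundMat p q l L).trace + 2 * σ‖ := by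
  set B := Real.exp (∫ s in (0 : ℝ)..L, ‖(q s : ℂ) + I * p s‖) * Real.exp (T * L) with hBdef
  have hB0 : 0 < B := by positivity
  set κ := L / (4 * B ^ 2) with hκ
  have hκ0 : 0 < κ := by positivity
  by_cases hT : 0 ≤ T
  swap
  · exact ⟨1, one_pos, fun l hl => absurd ((abs_nonneg _).trans hl) hT⟩
  refine ⟨κ ^ 2 / (1 + κ * T) / 2, by positivity, fun l hl => ?_⟩
  have hB : ∀ s ∈ Icc 0 L, ∀ i j, ‖fundMat p q l s i j‖ ≤ B := by
    intro s hs i j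
    refine (h.norm_fundMat_le l hs.1 i j).trans ?_
    rw [hBdef]
    gcongr
    · exact integral_mono_interval le_rfl hs.1 hs.2 (Eventually.of_forall fun _ => norm_nonneg _)
        (h.intervalIntegrable_coeff 0 L).norm
    · exact hs.1
    · exact hs.2
  have hdet : ‖(fundMat p q l L + (σ : ℂ) • 1).det‖ = ‖(fundMat p q l L).trace + 2 * σ‖ := by
    have hσ' : (σ : ℂ) ^ 2 = 1 := by exact_mod_cast hσ
    have hd := h.det_fundMat l L
    rw [Matrix.det_fin_two] at hd
    have e : (fundMat p q l L + (σ : ℂ) • 1).det = σ * ((fundMat p q l L).trace + 2 * σ) := by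
      rw [Matrix.det_fin_two, Matrix.trace_fin_two]
      simp
      linear_combination hd - hσ'
    rw [e, norm_mul, norm_real, Real.norm_eq_abs]
    have : |σ| = 1 := by
      rw [← sq_eq_sq₀ (abs_nonneg _) zero_le_one, sq_abs, hσ, one_pow]
    rw [this, one_mul]
  set ω := κ * |l.im| with hω
  have hω0 : 0 ≤ ω := by positivity
  have key : ω ^ 2 / (1 + ω) / 2 ≤ ‖(fundMat p q l L + (σ : ℂ) • 1).det‖ := by
    refine sq_le_norm_det (by positivity) fun a b => ?_
    have h1 := h.energy_lower_bound hL.le hB0 hB hσ a b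
    rw [← hκ, ← hω] at h1
    simp only [Matrix.add_apply, Matrix.smul_apply, Matrix.one_apply_eq, smul_eq_mul, mul_one,
      Matrix.one_apply_ne (zero_ne_one : (0 : Fin 2) ≠ 1),
      Matrix.one_apply_ne (one_ne_zero : (1 : Fin 2) ≠ 0), mul_zero, add_zero]
    set x := ‖(fundMat p q l L 0 0 + σ) * a + fundMat p q l L 0 1 * b‖
    set y := ‖fundMat p q l L 1 0 * a + (fundMat p q l L 1 1 + σ) * b‖
    rw [div_mul_eq_mul_div, div_le_iff₀ (by positivity)]
    have h2 := mul_le_mul_of_nonneg_left h1 hω0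
    -- AM-GM with weight `ω` absorbs the mixed terms `x ‖b‖` and `y ‖a‖` into the left side.
    nlinarith [sq_nonneg (x - ω * ‖b‖), sq_nonneg (y - ω * ‖a‖), mul_nonneg hω0 (sq_nonneg (x - y))]
  rw [hdet] at key
  refine le_trans ?_ key
  have e : κ ^ 2 / (1 + κ * T) / 2 * l.im ^ 2 = ω ^ 2 / (1 + κ * T) / 2 := by
    rw [hω, mul_pow, sq_abs]; ring
  rw [e]
  gcongr
  exact mul_le_mul_of_nonneg_left hl hκ0.le

theorem tendsto_trace (h : LocallyIntegrableEntries p q) {L : ℝ} (hL : 0 < L) (c : ℂ) :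
    Tendsto (fun l : ℂ => cexp (I * l * L) * ((fundMat p q l L).trace + c))
      (comap Complex.im atTop) (𝓝 1) := by
  have h0 : Tendsto (fun l : ℂ => cexp (I * l * L)) (comap Complex.im atTop) (𝓝 0) := by
    rw [tendsto_zero_iff_norm_tendsto_zero]
    simp only [norm_cexp_mul_ofReal]
    refine ((tendsto_exp_neg_im (c := L / 2) (by positivity))).congr fun l => ?_
    ring_nf
  have := ((h.tendsto_fundMat hL 0 0).add (h.tendsto_fundMat hL 1 1)).add (h0.mul_const c)
  refine (this.congr fun l => ?_).trans (le_of_eq ?_)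
  · rw [Matrix.trace_fin_two]; ring
  · congr 1
    simp [projPlus]; norm_num

/-- High-energy asymptotics cover `|Im l| ≥ T`, with the lower half-plane reached by conjugation;
the energy bound covers the strip `|Im l| ≤ T`. -/
theorem exists_trace_lower_bound (h : LocallyIntegrableEntries p q) {L : ℝ} (hL : 0 < L) {σ : ℝ}
    (hσ : σ ^ 2 = 1) : ∃ C, 0 < C ∧ ∀ l : ℂ, l.im ^ 2 * Real.exp (|l.im| * L) ≤
      C * (1 + l.im ^ 2) * ‖(fundMat p q l L).trace + 2 * σ‖ := by
  have hev : ∀ᶠ l in comap Complex.im atTop,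
      1 / 2 < ‖cexp (I * l * L) * ((fundMat p q l L).trace + 2 * σ)‖ := by
    refine (h.tendsto_trace hL (2 * σ)).norm.eventually_const_lt ?_
    rw [norm_one]; norm_num
  obtain ⟨T, -, hT⟩ := ((atTop_basis (α := ℝ)).comap Complex.im).eventually_iff.1 hev
  have hup : ∀ l : ℂ, T ≤ l.im →
      Real.exp (l.im * L) ≤ 2 * ‖(fundMat p q l L).trace + 2 * σ‖ := by
    intro l hl
    have := hT (show l ∈ Complex.im ⁻¹' Ici T from hl)
    rw [norm_mul, norm_cexp_mul_ofReal, neg_mul, Real.exp_neg, inv_mul_eq_div,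
      lt_div_iff₀ (Real.exp_pos _)] at this
    linarith
  have hdown : ∀ l : ℂ, T ≤ |l.im| →
      Real.exp (|l.im| * L) ≤ 2 * ‖(fundMat p q l L).trace + 2 * σ‖ := by
    intro l hl
    rcases le_total 0 l.im with h0 | h0
    · rw [abs_of_nonneg h0] at hl ⊢
      exact hup l hl
    · rw [abs_of_nonpos h0] at hl ⊢
      have := hup (starRingEnd ℂ l) (by simpa using hl)
      have e : (fundMat p q (starRingEnd ℂ l) L).trace + 2 * σ =
          starRingEnd ℂ ((fundMat p q l L).trace + 2 * σ) := by
        rw [h.fundMat_conj, Matrix.trace_fin_two, Matrix.trace_fin_two]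
        simp [← ofReal_ofNat]
      rw [e, norm_conj] at this
      simpa using this
  obtain ⟨c, hc, hlow⟩ := h.exists_det_lower_bound hL hσ T
  refine ⟨2 + Real.exp (T * L) / c, by positivity, fun l => ?_⟩
  set N := ‖(fundMat p q l L).trace + 2 * σ‖
  have hN : 0 ≤ N := norm_nonneg _
  rcases le_total T |l.im| with hl | hl
  · have h1 := hdown l hl
    calc l.im ^ 2 * Real.exp (|l.im| * L) ≤ l.im ^ 2 * (2 * N) := by gcongr
      _ ≤ 2 * (1 + l.im ^ 2) * N := by nlinarith
      _ ≤ _ := by gcongr; exact le_add_of_nonneg_right (by positivity)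
  · have h1 := hlow l hl
    have h2 : l.im ^ 2 ≤ N / c := by rwa [le_div_iff₀' hc]
    calc l.im ^ 2 * Real.exp (|l.im| * L) ≤ N / c * Real.exp (T * L) := by gcongr
      _ = Real.exp (T * L) / c * 1 * N := by ring
      _ ≤ _ := by
        gcongr
        · linarith
        · nlinarith [sq_nonneg l.im]

end LocallyIntegrableEntries

end DiracSystem

/-! ### When a critical trace forces a scalar matrix -/

namespace DiracSystem

open Set Filter Topology intervalIntegral Complex

variable {p q : ℝ → ℝ}

/-- A real unimodular matrix with `|tr| ≤ 2` whose associated quadratic form is orthogonal to a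
positive definite form is scalar. -/
theorem scalar_of_trace_gram_eq_zero {a b c d g₁ g₂ g₃ : ℝ} (hdet : a * d - b * c = 1)
    (htr : (a + d) ^ 2 ≤ 4) (hg : 0 < g₁) (hG : g₂ ^ 2 < g₁ * g₃)
    (h : b * g₁ + (d - a) * g₂ - c * g₃ = 0) : b = 0 ∧ c = 0 ∧ a = d := by
  -- The form `b x² + (d - a) x y - c y²` has nonpositive discriminant, hence is semidefinite.
  have h1 : (d - a) ^ 2 ≤ -4 * b * c := by nlinarith
  have h3 : 0 < g₃ := by
    by_contra! h3
    nlinarith [mul_nonneg hg.le (neg_nonneg.2 h3), sq_nonneg g₂]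
  -- Multiply the orthogonality relation by `4 b g₁` and complete the square; both summands are
  -- nonnegative, so both vanish.
  have h2 : (2 * b * g₁ + (d - a) * g₂) ^ 2 + (d - a) ^ 2 * (g₁ * g₃ - g₂ ^ 2) ≤ 0 := by
    have e : 4 * b * g₁ * (b * g₁ + (d - a) * g₂ - c * g₃) = 0 := by rw [h, mul_zero]
    nlinarith [mul_le_mul_of_nonneg_right h1 (mul_pos hg h3).le]
  have h4 : (d - a) ^ 2 * (g₁ * g₃ - g₂ ^ 2) = 0 := le_antisymm
    (by nlinarith [sq_nonneg (2 * b * g₁ + (d - a) * g₂)])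
    (mul_nonneg (sq_nonneg _) (sub_pos.2 hG).le)
  have h5 : d - a = 0 := by
    rcases mul_eq_zero.1 h4 with h5 | h5
    · exact pow_eq_zero_iff two_ne_zero |>.1 h5
    · linarith
  rw [h5] at h2 h
  have h6 : b = 0 := by
    have : (2 * b * g₁) ^ 2 = 0 := le_antisymm (by nlinarith) (sq_nonneg _)
    have := pow_eq_zero_iff two_ne_zero |>.1 this
    rcases mul_eq_zero.1 this with h6 | h6 <;> linarith
  rw [h6] at h
  have h7 : c = 0 := by
    have : c * g₃ = 0 := by linarith
    exact (mul_eq_zero.1 this).resolve_right h3.ne'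
  exact ⟨h6, h7, by linarith⟩

namespace LocallyIntegrableEntries

theorem fundMat_ofReal (h : LocallyIntegrableEntries p q) (x : ℝ) (z : ℝ) (i j : Fin 2) :
    ((fundMat p q x z i j).re : ℂ) = fundMat p q x z i j := by
  have := congrFun (congrFun (h.fundMat_conj x z) i) j
  rw [conj_ofReal, Matrix.map_apply] at this
  exact conj_eq_iff_re.1 this.symm

/-- For real spectral parameter the Gram matrix is real and positive definite. -/
theorem exists_gram_ofReal (h : LocallyIntegrableEntries p q) (x : ℝ) {L : ℝ} (hL : 0 < L) :
    ∃ g₁ g₂ g₃ : ℝ, gram p q x x L = !![(g₁ : ℂ), g₂; g₂, g₃] ∧ 0 < g₁ ∧ g₂ ^ 2 < g₁ * g₃ := by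
  set y : Fin 2 → Fin 2 → ℝ → ℝ := fun i j s => (fundMat p q x s i j).re with hy
  have hyc : ∀ i j, Continuous (y i j) := fun i j =>
    continuous_re.comp (h.continuous_fundMat x i j)
  have hY : ∀ s i j, fundMat p q x s i j = (y i j s : ℂ) := fun s i j =>
    (h.fundMat_ofReal x s i j).symm
  have hd : ∀ s, y 0 0 s * y 1 1 s - y 0 1 s * y 1 0 s = 1 := by
    intro s
    have := h.det_fundMat x s
    rw [Matrix.det_fin_two, hY, hY, hY, hY] at this
    exact_mod_cast this
  let G : Fin 2 → Fin 2 → ℝ := fun i j =>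
    ∫ s in (0 : ℝ)..L, (y 0 i s * y 0 j s + y 1 i s * y 1 j s)
  have hG : ∀ i j, gram p q x x L i j = G i j := by
    intro i j
    simp only [gram, Matrix.of_apply, G]
    rw [← intervalIntegral.integral_ofReal]
    refine integral_congr fun s _ => ?_
    simp only [hY]
    push_cast
    ring
  have hi : ∀ i j, IntervalIntegrable (fun s => y 0 i s * y 0 j s + y 1 i s * y 1 j s) volume 0 L :=
    fun i j => Continuous.intervalIntegrable
      (((hyc _ _).mul (hyc _ _)).add ((hyc _ _).mul (hyc _ _))) _ _
  have hsymm : G 1 0 = G 0 1 := by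
    simp only [G]; congr 1; funext s; ring
  have hpos : ∀ α β : ℝ, (α ≠ 0 ∨ β ≠ 0) →
      0 < α ^ 2 * G 0 0 + 2 * α * β * G 0 1 + β ^ 2 * G 1 1 := by
    intro α β hαβ
    have e : α ^ 2 * G 0 0 + 2 * α * β * G 0 1 + β ^ 2 * G 1 1 = ∫ s in (0 : ℝ)..L,
        ((α * y 0 0 s + β * y 0 1 s) ^ 2 + (α * y 1 0 s + β * y 1 1 s) ^ 2) := by
      simp only [G]
      rw [← intervalIntegral.integral_const_mul, ← intervalIntegral.integral_const_mul,
        ← intervalIntegral.integral_const_mul, ← intervalIntegral.integral_add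
          ((hi 0 0).const_mul _) ((hi 0 1).const_mul _), ← intervalIntegral.integral_add
          (((hi 0 0).const_mul _).add ((hi 0 1).const_mul _)) ((hi 1 1).const_mul _)]
      congr 1
      funext s
      ring
    rw [e]
    refine intervalIntegral_pos_of_pos (Continuous.intervalIntegrable ?_ _ _) (fun s => ?_) hL
    · have := hyc 0 0; have := hyc 0 1; have := hyc 1 0; have := hyc 1 1
      fun_prop
    · rcases (add_nonneg (sq_nonneg (α * y 0 0 s + β * y 0 1 s))
        (sq_nonneg (α * y 1 0 s + β * y 1 1 s))).lt_or_eq with hlt | heq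
      · exact hlt
      · exfalso
        have h1 : α * y 0 0 s + β * y 0 1 s = 0 := by
          nlinarith [sq_nonneg (α * y 0 0 s + β * y 0 1 s),
            sq_nonneg (α * y 1 0 s + β * y 1 1 s)]
        have h2 : α * y 1 0 s + β * y 1 1 s = 0 := by
          nlinarith [sq_nonneg (α * y 0 0 s + β * y 0 1 s),
            sq_nonneg (α * y 1 0 s + β * y 1 1 s)]
        have hα : α = 0 := by linear_combination (-α) * hd s + y 1 1 s * h1 - y 0 1 s * h2
        have hβ : β = 0 := by linear_combination (-β) * hd s + y 0 0 s * h2 - y 1 0 s * h1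
        tauto
  have h0 : 0 < G 0 0 := by simpa using hpos 1 0 (by simp)
  refine ⟨G 0 0, G 0 1, G 1 1, ?_, h0, ?_⟩
  · ext i j
    rw [hG]
    fin_cases i <;> fin_cases j <;> simp [hsymm]
  · have := hpos (-G 0 1) (G 0 0) (Or.inr h0.ne')
    have e : (-G 0 1) ^ 2 * G 0 0 + 2 * -G 0 1 * G 0 0 * G 0 1 + G 0 0 ^ 2 * G 1 1 =
      G 0 0 * (G 0 0 * G 1 1 - G 0 1 ^ 2) := by ring
    rw [e] at this
    linarith [(mul_pos_iff_of_pos_left h0).1 this]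

/-- `tr (N J G)` is, up to sign, the pairing of the quadratic form of `N` with the positive definite
`G`. It is also, up to sign, a spectral derivative of a trace, so this lemma governs the
multiplicity of zeros. -/
theorem eq_smul_one_of_trace_eq_zero (h : LocallyIntegrableEntries p q) (x : ℝ) {L : ℝ}
    (hL : 0 < L) {N : Matrix (Fin 2) (Fin 2) ℂ} (hN : ∀ i j, ((N i j).re : ℂ) = N i j)
    (hdet : N.det = 1) (htr : N.trace.re ^ 2 ≤ 4) (h0 : (N * J * gram p q x x L).trace = 0) :
    N = N 0 0 • 1 := by
  obtain ⟨g₁, g₂, g₃, hg, hg1, hg2⟩ := h.exists_gram_ofReal x hL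
  set a := (N 0 0).re
  set b := (N 0 1).re
  set c := (N 1 0).re
  set d := (N 1 1).re
  have hNe : N = !![(a : ℂ), b; c, d] := by
    ext i j
    rw [← hN]
    fin_cases i <;> fin_cases j <;> rfl
  rw [hg, hNe] at h0
  simp [J, Matrix.trace_fin_two] at h0
  rw [hNe, Matrix.det_fin_two] at hdet
  simp at hdet
  rw [Matrix.trace_fin_two, add_re] at htr
  have h1 : a * d - b * c = 1 := by exact_mod_cast hdet
  have h2 : b * g₁ + (d - a) * g₂ - c * g₃ = 0 := by
    have : -(b * g₁ + (d - a) * g₂ - c * g₃) = 0 := by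
      have h0' : -((b : ℂ) * g₁) + a * g₂ + (-(d * g₂) + c * g₃) = 0 := h0
      have : -(b * g₁) + a * g₂ + (-(d * g₂) + c * g₃) = 0 := by exact_mod_cast h0'
      linarith
    linarith
  obtain ⟨hb, hc, had⟩ := scalar_of_trace_gram_eq_zero h1 htr hg1 hg2 h2
  rw [hNe, hb, hc, ← had]
  ext i j
  fin_cases i <;> fin_cases j <;> simp

end LocallyIntegrableEntries

end DiracSystem

/-! ### Entire quotients and a Liouville theorem -/

namespace DiracSystem

open Set Filter Topology Complex

theorem exists_local_quotient {F h : ℂ → ℂ} {z : ℂ} (hF : AnalyticAt ℂ F z) (hh : AnalyticAt ℂ h z)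
    (hne : analyticOrderAt h z ≠ ⊤) (ho : analyticOrderAt h z ≤ analyticOrderAt F z) :
    ∃ φ : ℂ → ℂ, AnalyticAt ℂ φ z ∧ ∀ᶠ w in 𝓝 z, F w = φ w * h w := by
  obtain ⟨n, hn⟩ := ENat.ne_top_iff_exists.1 hne
  obtain ⟨h₁, h₁a, h₁0, h₁e⟩ := (hh.analyticOrderAt_eq_natCast).1 hn.symm
  obtain ⟨F₁, F₁a, F₁e⟩ := (natCast_le_analyticOrderAt hF).1 (hn ▸ ho)
  refine ⟨fun w => F₁ w / h₁ w, F₁a.div h₁a h₁0, ?_⟩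
  filter_upwards [h₁e, F₁e, h₁a.continuousAt.eventually_ne h₁0] with w e1 e2 e3
  rw [e1, e2]
  simp only [smul_eq_mul]
  field_simp

/-- Local quotients agree where `h ≠ 0`, hence everywhere by continuity, so the diagonal choice `φ w
w` is entire. -/
theorem exists_entire_quotient {F h : ℂ → ℂ} (hF : Differentiable ℂ F) (hh : Differentiable ℂ h)
    (hne : ∀ z, analyticOrderAt h z ≠ ⊤) (ho : ∀ z, analyticOrderAt h z ≤ analyticOrderAt F z) :
    ∃ g : ℂ → ℂ, Differentiable ℂ g ∧ ∀ z, F z = g z * h z := by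
  choose φ hφa hφ using fun z => exists_local_quotient (hF.analyticAt z) (hh.analyticAt z)
    (hne z) (ho z)
  have hnz : ∀ w, ∀ᶠ x in 𝓝[≠] w, h x ≠ 0 := fun w =>
    ((hh.analyticAt w).eventually_eq_zero_or_eventually_ne_zero).resolve_left
      fun h0 => hne w (analyticOrderAt_eq_top.2 h0)
  have hloc : ∀ z, (fun w => φ w w) =ᶠ[𝓝 z] φ z := by
    intro z
    filter_upwards [(hφ z).eventually_nhds, (hφa z).eventually_analyticAt] with w hw hwa
    have : φ w =ᶠ[𝓝[≠] w] φ z := by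
      filter_upwards [hnz w, nhdsWithin_le_nhds (hφ w), nhdsWithin_le_nhds hw] with x h1 h2 h3
      exact mul_right_cancel₀ h1 (h2.symm.trans h3)
    exact (((hφa w).continuousAt.eventuallyEq_nhds_iff_eventuallyEq_nhdsNE
      hwa.continuousAt).1 this).eq_of_nhds
  refine ⟨fun w => φ w w, fun z => ?_, fun z => (hφ z).self_of_nhds⟩
  exact ((hφa z).congr (hloc z).symm).differentiableAt

/-- Makes `(u² - 1)²` the multiplier that cancels a singularity of order `(Im u)⁻²` on the unit
circle. -/
theorem norm_sq_sub_one_of_norm_eq_one {u : ℂ} (hu : ‖u‖ = 1) : ‖u ^ 2 - 1‖ = 2 * |u.im| := by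
  have h1 : u * starRingEnd ℂ u = 1 := by
    rw [mul_conj, normSq_eq_norm_sq, hu]; simp
  have e : u ^ 2 - 1 = u * (u - starRingEnd ℂ u) := by rw [mul_sub, h1, sq]
  rw [e, norm_mul, hu, one_mul, sub_conj, norm_mul, norm_I, mul_one, norm_real, Real.norm_eq_abs,
    abs_mul, abs_two]

/-- An entire function with at most a quadratic singularity of its bound on the real axis is
bounded. -/
theorem norm_le_of_norm_mul_sq_im_le {g : ℂ → ℂ} (hg : Differentiable ℂ g) {C : ℝ} (hC : 0 ≤ C)
    (hb : ∀ z, ‖g z‖ * z.im ^ 2 ≤ C * (1 + z.im ^ 2)) (z : ℂ) : ‖g z‖ ≤ 16 * C := by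
  rcases le_total (1 / 2) |z.im| with hz | hz
  · have h1 := hb z
    have h2 : 1 / 4 ≤ z.im ^ 2 := by
      rw [← sq_abs]; nlinarith
    have h3 := norm_nonneg (g z)
    by_contra! hlt
    nlinarith [mul_le_mul_of_nonneg_right hlt.le (sq_nonneg z.im)]
  · set x : ℂ := (z.re : ℂ) with hx
    have hxim : x.im = 0 := ofReal_im _
    -- On the unit circle about `x` the factor has modulus `4 (Im w)²`, so `‖f‖ ≤ 8C` there; at `z`
    -- it is at least `(3/4)²`, and the maximum principle gives the bound for `g z`.
    let f : ℂ → ℂ := fun w => ((w - x) ^ 2 - 1) ^ 2 * g w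
    have hf : Differentiable ℂ f := by fun_prop
    have hzx : ‖z - x‖ = |z.im| := by
      have : z - x = z.im * I := by
        apply Complex.ext <;> simp [hx]
      rw [this, norm_mul, norm_I, mul_one, norm_real, Real.norm_eq_abs]
    have hmax : ‖f z‖ ≤ 8 * C := by
      refine Complex.norm_le_of_forall_mem_frontier_norm_le (U := Metric.ball x 1)
        Metric.isBounded_ball hf.diffContOnCl (fun w hw => ?_) (subset_closure ?_)
      · rw [frontier_ball x one_ne_zero, mem_sphere_iff_norm] at hw
        have hw1 : |w.im| ≤ 1 := by
          have := abs_im_le_norm (w - x)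
          rwa [hw, sub_im, hxim, sub_zero] at this
        have hw2 : w.im ^ 2 ≤ 1 := by rw [← sq_abs]; nlinarith [abs_nonneg w.im]
        simp only [f]
        rw [norm_mul, norm_pow, norm_sq_sub_one_of_norm_eq_one hw, sub_im, hxim, sub_zero, mul_pow,
          sq_abs]
        have := hb w
        nlinarith
      · rw [Metric.mem_ball, dist_eq_norm, hzx]
        linarith
    have hlow : 3 / 4 ≤ ‖(z - x) ^ 2 - 1‖ := by
      have h1 := norm_sub_norm_le (1 : ℂ) ((z - x) ^ 2)
      rw [norm_one, norm_pow, hzx, norm_sub_rev] at h1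
      nlinarith [abs_nonneg z.im]
    simp only [f] at hmax
    rw [norm_mul, norm_pow] at hmax
    have h3 := norm_nonneg (g z)
    have h4 : (3 / 4 : ℝ) ^ 2 ≤ ‖(z - x) ^ 2 - 1‖ ^ 2 := by gcongr
    nlinarith [mul_le_mul_of_nonneg_right h4 h3]

/-- A Liouville theorem for quotients of entire functions. -/
theorem eq_mul_of_quotient_bound {F h : ℂ → ℂ} {C : ℝ} {T : ℂ} (hF : Differentiable ℂ F)
    (hh : Differentiable ℂ h) (hne : ∀ z, analyticOrderAt h z ≠ ⊤)
    (ho : ∀ z, analyticOrderAt h z ≤ analyticOrderAt F z) (hC : 0 ≤ C)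
    (hb : ∀ z, ‖F z‖ * z.im ^ 2 ≤ C * (1 + z.im ^ 2) * ‖h z‖)
    (hlim : Tendsto (fun z => F z / h z) (comap Complex.im atTop) (𝓝 T))
    (hnz : ∀ᶠ z in comap Complex.im atTop, h z ≠ 0) (z : ℂ) : F z = T * h z := by
  obtain ⟨g, hg, hgF⟩ := exists_entire_quotient hF hh hne ho
  have hgb : ∀ z, ‖g z‖ * z.im ^ 2 ≤ C * (1 + z.im ^ 2) := by
    intro z
    -- Division by `h` is possible only off its zeros; these are isolated, and the inequality is a
    -- closed condition.
    have hfr : ∃ᶠ x in 𝓝 z, ‖g x‖ * x.im ^ 2 ≤ C * (1 + x.im ^ 2) := by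
      have hev : ∀ᶠ x in 𝓝[≠] z, h x ≠ 0 :=
        ((hh.analyticAt z).eventually_eq_zero_or_eventually_ne_zero).resolve_left
          fun h0 => hne z (analyticOrderAt_eq_top.2 h0)
      refine Frequently.filter_mono (hev.mono fun x hx => ?_).frequently nhdsWithin_le_nhds
      have := hb x
      rw [hgF x, norm_mul] at this
      have h0 : 0 < ‖h x‖ := norm_pos_iff.2 hx
      refine le_of_mul_le_mul_right (le_trans (le_of_eq ?_) this) h0
      ring
    have hclosed : IsClosed {x : ℂ | ‖g x‖ * x.im ^ 2 ≤ C * (1 + x.im ^ 2)} := by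
      have := hg.continuous
      have := continuous_im
      exact isClosed_le (by fun_prop) (by fun_prop)
    exact hclosed.mem_of_frequently_of_tendsto hfr tendsto_id
  have hbdd : Bornology.IsBounded (range g) := by
    refine (Metric.isBounded_closedBall (x := (0 : ℂ)) (r := 16 * C)).subset ?_
    rintro _ ⟨z, rfl⟩
    rw [mem_closedBall_zero_iff]
    exact norm_le_of_norm_mul_sq_im_le hg hC hgb z
  have hconst : ∀ w, g w = g z := fun w => hg.apply_eq_apply_of_bounded hbdd w z
  have hlim' : Tendsto (fun _ : ℂ => g z) (comap Complex.im atTop) (𝓝 T) := by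
    refine hlim.congr' ?_
    filter_upwards [hnz] with w hw
    rw [hgF w, hconst w, mul_div_assoc, div_self hw, mul_one]
  have : NeBot (comap Complex.im atTop) := comap_neBot_iff_frequently.2
    (Eventually.frequently (Eventually.of_forall fun y => ⟨⟨0, y⟩, rfl⟩))
  rw [hgF z, tendsto_nhds_unique tendsto_const_nhds hlim']

end DiracSystem

/-! ### Comparison of transition matrices over adjacent half periods -/

namespace DiracSystem

open Set Filter Topology Complex

variable {p q p' q' : ℝ → ℝ} {l : ℂ} {u v : ℝ → ℂ}

namespace IsSolution

theorem congr_potential (h : IsSolution p q l u v) (hp : p =ᵐ[volume] p') (hq : q =ᵐ[volume] q') :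
    IsSolution p' q' l u v :=
  ⟨h.fst.congr (by filter_upwards [hp, hq] with z h1 h2; rw [h1, h2]),
    h.snd.congr (by filter_upwards [hp, hq] with z h1 h2; rw [h1, h2])⟩

/-- A matrix `α + β J` maps solutions for `Q` to solutions for `σ Q` if `σ α = α`, `σ β = -β`. -/
theorem rotate (h : IsSolution p q l u v) {σ : ℝ} {α β : ℂ} (hα : σ * α = α) (hβ : σ * β = -β) :
    IsSolution (fun z => σ * p z) (fun z => σ * q z) l (fun z => α * u z + β * v z)
      (fun z => -β * u z + α * v z) := by
  refine ⟨((h.fst.const_mul α).add (h.snd.const_mul β)).congr (Eventually.of_forall fun z => ?_),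
    ((h.fst.const_mul (-β)).add (h.snd.const_mul α)).congr (Eventually.of_forall fun z => ?_)⟩
  · push_cast
    linear_combination (-q z * u z + p z * v z) * hα + (-q z * v z - p z * u z) * hβ
  · push_cast
    linear_combination (p z * u z + q z * v z) * hα + (-q z * u z + p z * v z) * hβ

/-- A system is determined by a fundamental system of solutions. -/
theorem potential_ae_eq {u' v' : ℝ → ℂ} (h : IsSolution p q l u v) (h' : IsSolution p' q' l u v)
    (g : IsSolution p q l u' v') (g' : IsSolution p' q' l u' v')
    (hw : ∀ z, u z * v' z - v z * u' z ≠ 0) : ∀ᵐ z, p z = p' z ∧ q z = q' z := by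
  filter_upwards [h.fst.hasDerivAt, h'.fst.hasDerivAt, g.fst.hasDerivAt, g'.fst.hasDerivAt]
    with z h1 h2 g1 g2
  have e1 := h1.unique h2
  have e2 := g1.unique g2
  have hp : ((p z : ℂ) - p' z) * (u z * v' z - v z * u' z) = 0 := by
    linear_combination u' z * e1 - u z * e2
  have hq : ((q z : ℂ) - q' z) * (u z * v' z - v z * u' z) = 0 := by
    linear_combination v' z * e1 - v z * e2
  have hp := (mul_eq_zero.1 hp).resolve_right (hw z)
  have hq := (mul_eq_zero.1 hq).resolve_right (hw z)
  exact ⟨by exact_mod_cast sub_eq_zero.1 hp, by exact_mod_cast sub_eq_zero.1 hq⟩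

end IsSolution

/-- The transition matrix of the system from `t` to `t + π / 2`. -/
noncomputable def transition (p q : ℝ → ℝ) (t : ℝ) (l : ℂ) : Matrix (Fin 2) (Fin 2) ℂ :=
  fundMat (fun z => p (z + t)) (fun z => q (z + t)) l (Real.pi / 2)

/-- The combination of transition matrices over two adjacent half periods which is a scalar
multiple of a fixed matrix when `Q (z + π / 2) = σ Q z`. -/
noncomputable def comparison (p q : ℝ → ℝ) (σ : ℝ) (t : ℝ) (l : ℂ) : Matrix (Fin 2) (Fin 2) ℂ :=
  (transition p q (t + Real.pi / 2) l).adjugate + (σ : ℂ) • transition p q t l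

/-- The limit of the normalized comparison matrix at high energy. -/
noncomputable def comparisonLimit (σ : ℝ) : Matrix (Fin 2) (Fin 2) ℂ :=
  projPlus.adjugate + (σ : ℂ) • projPlus

theorem adjugate_fin_two_apply (i j : Fin 2) : ∃ i' j' : Fin 2, ∃ ε : ℂ, ‖ε‖ = 1 ∧
    ∀ A : Matrix (Fin 2) (Fin 2) ℂ, A.adjugate i j = ε * A i' j' := by
  fin_cases i <;> fin_cases j
  · exact ⟨1, 1, 1, by simp, fun A => by simp [Matrix.adjugate_fin_two]⟩
  · exact ⟨0, 1, -1, by simp, fun A => by simp [Matrix.adjugate_fin_two]⟩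
  · exact ⟨1, 0, -1, by simp, fun A => by simp [Matrix.adjugate_fin_two]⟩
  · exact ⟨0, 0, 1, by simp, fun A => by simp [Matrix.adjugate_fin_two]⟩

namespace LocallyIntegrableEntries

theorem differentiable_comparison (h : LocallyIntegrableEntries p q) (σ t : ℝ) (i j : Fin 2) :
    Differentiable ℂ fun l => comparison p q σ t l i j := by
  obtain ⟨i', j', ε, -, hε⟩ := adjugate_fin_two_apply i j
  simp only [comparison, Matrix.add_apply, Matrix.smul_apply, hε, smul_eq_mul]
  have h1 := (h.shift (t + Real.pi / 2)).differentiable_fundMat Real.pi_div_two_pos.le i' j'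
  have h2 := (h.shift t).differentiable_fundMat Real.pi_div_two_pos.le i j
  exact (h1.const_mul ε).add (h2.const_mul _)

theorem exists_norm_comparison_le (h : LocallyIntegrableEntries p q) (σ t : ℝ) (i j : Fin 2) :
    ∃ C, 0 ≤ C ∧ ∀ l : ℂ, ‖comparison p q σ t l i j‖ ≤ C * Real.exp (|l.im| * (Real.pi / 2)) := by
  obtain ⟨i', j', ε, hε1, hε⟩ := adjugate_fin_two_apply i j
  refine ⟨Real.exp (∫ s in (0 : ℝ)..Real.pi / 2,
      ‖(q (s + (t + Real.pi / 2)) : ℂ) + I * p (s + (t + Real.pi / 2))‖) + |σ| *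
    Real.exp (∫ s in (0 : ℝ)..Real.pi / 2, ‖(q (s + t) : ℂ) + I * p (s + t)‖), by positivity,
    fun l => ?_⟩
  simp only [comparison, Matrix.add_apply, Matrix.smul_apply, hε, smul_eq_mul]
  have h1 := (h.shift (t + Real.pi / 2)).norm_fundMat_le l Real.pi_div_two_pos.le i' j'
  have h2 := (h.shift t).norm_fundMat_le l Real.pi_div_two_pos.le i j
  refine (norm_add_le _ _).trans ?_
  rw [norm_mul, norm_mul, hε1, one_mul, norm_real, Real.norm_eq_abs, add_mul, mul_assoc]
  exact add_le_add h1 (mul_le_mul_of_nonneg_left h2 (abs_nonneg _))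

theorem tendsto_comparison (h : LocallyIntegrableEntries p q) (σ t : ℝ) (i j : Fin 2) :
    Tendsto (fun l : ℂ => cexp (I * l * (Real.pi / 2 : ℝ)) * comparison p q σ t l i j)
      (comap Complex.im atTop) (𝓝 (comparisonLimit σ i j)) := by
  obtain ⟨i', j', ε, -, hε⟩ := adjugate_fin_two_apply i j
  simp only [comparison, comparisonLimit, Matrix.add_apply, Matrix.smul_apply, hε, smul_eq_mul]
  have h1 := (h.shift (t + Real.pi / 2)).tendsto_fundMat Real.pi_div_two_pos i' j'
  have h2 := (h.shift t).tendsto_fundMat Real.pi_div_two_pos i j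
  refine ((h1.const_mul ε).add (h2.const_mul (σ : ℂ))).congr fun l => ?_
  simp only [transition]
  ring

theorem fundMat_add_pi (h : LocallyIntegrableEntries p q) (hp : Function.Periodic p Real.pi)
    (hq : Function.Periodic q Real.pi) (l : ℂ) (t : ℝ) :
    fundMat p q l (t + Real.pi) = fundMat p q l t * fundMat p q l Real.pi := by
  have := h.fundMat_add l Real.pi t
  simp only [hp _, hq _] at this
  exact this

theorem fundMat_add_half (h : LocallyIntegrableEntries p q) (l : ℂ) (t : ℝ) :
    fundMat p q l (t + Real.pi / 2) = transition p q t l * fundMat p q l t := by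
  rw [add_comm, h.fundMat_add l t (Real.pi / 2), transition]

theorem det_transition (h : LocallyIntegrableEntries p q) (t : ℝ) (l : ℂ) :
    (transition p q t l).det = 1 := (h.shift t).det_fundMat l _

theorem transition_mul (h : LocallyIntegrableEntries p q) (hp : Function.Periodic p Real.pi)
    (hq : Function.Periodic q Real.pi) (l : ℂ) (t : ℝ) :
    transition p q (t + Real.pi / 2) l * (transition p q t l * fundMat p q l t) =
      fundMat p q l t * fundMat p q l Real.pi := by
  rw [← h.fundMat_add_half, ← h.fundMat_add_half, ← h.fundMat_add_pi hp hq]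
  congr 1
  ring

/-- From `T_{t+π/2} T_t Y(t) = Y(t) M` and unimodularity, `adj T_{t+π/2} · Y(t) = T_t Y(t) adj M`;
add `σ T_t Y(t)`. -/
theorem comparison_mul (h : LocallyIntegrableEntries p q) (hp : Function.Periodic p Real.pi)
    (hq : Function.Periodic q Real.pi) (σ : ℝ) (l : ℂ) (t : ℝ) :
    comparison p q σ t l * fundMat p q l t = fundMat p q l (t + Real.pi / 2) *
      ((fundMat p q l Real.pi).adjugate + (σ : ℂ) • 1) := by
  have h1 := h.transition_mul hp hq l t
  have hB := h.det_transition (t + Real.pi / 2) l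
  have hM := h.det_fundMat l Real.pi
  have h2 : (transition p q (t + Real.pi / 2) l).adjugate * fundMat p q l t =
      transition p q t l * fundMat p q l t * (fundMat p q l Real.pi).adjugate := by
    calc _ = (transition p q (t + Real.pi / 2) l).adjugate * (fundMat p q l t *
          (fundMat p q l Real.pi * (fundMat p q l Real.pi).adjugate)) := by
          rw [Matrix.mul_adjugate, hM, one_smul, mul_one]
      _ = _ := by
          rw [← mul_assoc (fundMat p q l t), ← h1, ← mul_assoc, ← mul_assoc,
            Matrix.adjugate_mul, hB, one_smul, one_mul]
  rw [comparison, add_mul, h2, mul_add, ← h.fundMat_add_half, Matrix.smul_mul,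
    ← h.fundMat_add_half, Matrix.mul_smul, mul_one]

/-- The comparison matrix vanishes where the monodromy matrix is `-σ`. -/
theorem comparison_eq_zero (h : LocallyIntegrableEntries p q) (hp : Function.Periodic p Real.pi)
    (hq : Function.Periodic q Real.pi) {σ : ℝ} {l : ℂ}
    (hM : fundMat p q l Real.pi = -(σ : ℂ) • 1) (t : ℝ) : comparison p q σ t l = 0 := by
  have h1 := h.comparison_mul hp hq σ l t
  have e : (-(σ : ℂ) • (1 : Matrix (Fin 2) (Fin 2) ℂ)).adjugate + (σ : ℂ) • 1 = 0 := by
    rw [Matrix.adjugate_fin_two]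
    ext i j
    fin_cases i <;> fin_cases j <;> simp
  rw [hM, e, mul_zero] at h1
  calc comparison p q σ t l =
      comparison p q σ t l * fundMat p q l t * (fundMat p q l t).adjugate := by
        rw [mul_assoc, Matrix.mul_adjugate, h.det_fundMat, one_smul, mul_one]
    _ = 0 := by rw [h1, zero_mul]

theorem im_eq_zero_of_trace (h : LocallyIntegrableEntries p q) {σ : ℝ} (hσ : σ ^ 2 = 1) {l : ℂ}
    (hl : (fundMat p q l Real.pi).trace + 2 * σ = 0) : l.im = 0 := by
  obtain ⟨C, -, hC⟩ := h.exists_trace_lower_bound Real.pi_pos hσ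
  have := hC l
  rw [hl, norm_zero, mul_zero] at this
  have h1 := Real.exp_pos (|l.im| * Real.pi)
  have h2 : l.im ^ 2 ≤ 0 := by
    by_contra! h2
    linarith [mul_pos h2 h1]
  exact pow_eq_zero_iff two_ne_zero |>.1 (le_antisymm h2 (sq_nonneg _))

theorem hasDerivAt_trace_mul (h : LocallyIntegrableEntries p q) (R : Matrix (Fin 2) (Fin 2) ℂ)
    (l : ℂ) {z : ℝ} (hz : 0 ≤ z) :
    HasDerivAt (fun m => (R * fundMat p q m z).trace)
      (-(R * fundMat p q l z * J * gram p q l l z).trace) l := by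
  have h1 := fun i j => h.hasDerivAt_fundMat l hz i j
  simp only [Matrix.trace_fin_two, Matrix.mul_apply (M := R), Fin.sum_univ_two]
  have := (((h1 0 0).const_mul (R 0 0)).add ((h1 1 0).const_mul (R 0 1))).add
    (((h1 0 1).const_mul (R 1 0)).add ((h1 1 1).const_mul (R 1 1)))
  refine this.congr_deriv ?_
  have e : R * fundMat p q l z * J * gram p q l l z =
      R * (fundMat p q l z * J * gram p q l l z) := by
    simp only [mul_assoc]
  rw [e, Matrix.mul_apply (M := R), Matrix.mul_apply (M := R), Fin.sum_univ_two, Fin.sum_univ_two]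
  ring

/-- A double zero lies on the real axis and is a critical point of `Δ` with `|Δ| = 2`, so the
monodromy matrix is scalar; its trace fixes the scalar. -/
theorem fundMat_pi_eq (h : LocallyIntegrableEntries p q) {σ : ℝ} (hσ : σ ^ 2 = 1)
    (hd : HasOnlyDoubleZeros fun l => (fundMat p q l Real.pi).trace + 2 * σ) {l : ℂ}
    (hl : (fundMat p q l Real.pi).trace + 2 * σ = 0) : fundMat p q l Real.pi = -(σ : ℂ) • 1 := by
  have him := h.im_eq_zero_of_trace hσ hl
  obtain ⟨x, rfl⟩ : ∃ x : ℝ, l = x := ⟨l.re, by apply Complex.ext <;> simp [him]⟩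
  have hder : HasDerivAt (fun m => (fundMat p q m Real.pi).trace + 2 * σ)
      (-(fundMat p q x Real.pi * J * gram p q x x Real.pi).trace) (x : ℂ) := by
    have := (h.hasDerivAt_trace_mul 1 x Real.pi_pos.le).add_const (2 * (σ : ℂ))
    simpa only [one_mul] using this
  have hdiff : Differentiable ℂ fun m => (fundMat p q m Real.pi).trace + 2 * σ := fun m => by
    have := (h.hasDerivAt_trace_mul 1 m Real.pi_pos.le).add_const (2 * (σ : ℂ))
    simp only [one_mul] at this
    exact this.differentiableAt
  have h0 : (fundMat p q x Real.pi * J * gram p q x x Real.pi).trace = 0 := by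
    by_contra hne
    have := (hdiff.analyticAt (x : ℂ)).analyticOrderAt_eq_one_of_zero_deriv_ne_zero hl
      (by rw [hder.deriv]; exact neg_ne_zero.2 hne)
    rw [hd _ hl] at this
    exact absurd this (by decide)
  have htr : (fundMat p q x Real.pi).trace = ((-2 * σ : ℝ) : ℂ) := by
    push_cast; linear_combination hl
  have := h.eq_smul_one_of_trace_eq_zero x Real.pi_pos (h.fundMat_ofReal x Real.pi)
    (h.det_fundMat _ _) (by rw [htr, ofReal_re]; nlinarith) h0
  have h2 : fundMat p q x Real.pi 0 0 = -(σ : ℂ) := by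
    rw [this] at htr
    rw [Matrix.trace_smul, Matrix.trace_one] at htr
    push_cast at htr
    simp at htr
    linear_combination htr / 2
  rw [this, h2]

end LocallyIntegrableEntries

end DiracSystem

/-! ### The two implications for a sign `σ` -/

namespace DiracSystem

open Set Filter Topology Complex

variable {p q : ℝ → ℝ}

theorem comparisonLimit_eq (σ : ℝ) : comparisonLimit σ =
    !![((1 + σ) / 2 : ℂ), I * (1 - σ) / 2; -(I * (1 - σ) / 2), (1 + σ) / 2] := by
  ext i j
  fin_cases i <;> fin_cases j <;>
    simp [comparisonLimit, projPlus, Matrix.adjugate_fin_two] <;> ring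

/-- The limit is `1` for `σ = 1` and `iJ` for `σ = -1`. This combination of its entries is 1 in both
cases, so one scalar factor serves both signs. -/
theorem comparisonLimit_sub (σ : ℝ) :
    comparisonLimit σ 0 0 - I * comparisonLimit σ 0 1 = 1 := by
  simp [comparisonLimit_eq]
  linear_combination ((σ : ℂ) / 2 - 1 / 2) * I_sq

namespace LocallyIntegrableEntries

theorem differentiable_trace (h : LocallyIntegrableEntries p q) {z : ℝ} (hz : 0 ≤ z) (c : ℂ) :
    Differentiable ℂ fun l => (fundMat p q l z).trace + c := fun l => by
  have := (h.hasDerivAt_trace_mul 1 l hz).add_const c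
  simp only [one_mul] at this
  exact this.differentiableAt

/-- Each factor on the left vanishes at every zero of `Δ + 2σ`, so the product matches the double
zeros. Each factor has half the exponential type of `Δ`, so the quotient satisfies the Liouville
bound. -/
theorem comparison_mul_comparison (h : LocallyIntegrableEntries p q)
    (hp : Function.Periodic p Real.pi) (hq : Function.Periodic q Real.pi) {σ : ℝ}
    (hσ : σ ^ 2 = 1)
    (hd : HasOnlyDoubleZeros fun l => (fundMat p q l Real.pi).trace + 2 * σ)
    (t : ℝ) (l : ℂ) (i j : Fin 2) :
    comparison p q σ t l i j * (comparison p q σ 0 l 0 0 - I * comparison p q σ 0 l 0 1) =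
      comparisonLimit σ i j * ((fundMat p q l Real.pi).trace + 2 * σ) := by
  have hX := h.differentiable_comparison σ t i j
  have hξ : Differentiable ℂ fun l => comparison p q σ 0 l 0 0 - I * comparison p q σ 0 l 0 1 :=
    (h.differentiable_comparison σ 0 0 0).sub ((h.differentiable_comparison σ 0 0 1).const_mul I)
  have hh := h.differentiable_trace Real.pi_pos.le (2 * (σ : ℂ))
  obtain ⟨C₁, hC₁0, hC₁⟩ := h.exists_norm_comparison_le σ t i j
  obtain ⟨C₂, hC₂0, hC₂⟩ := h.exists_norm_comparison_le σ 0 0 0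
  obtain ⟨C₃, hC₃0, hC₃⟩ := h.exists_norm_comparison_le σ 0 0 1
  obtain ⟨C, hC0, hC⟩ := h.exists_trace_lower_bound Real.pi_pos hσ
  refine eq_mul_of_quotient_bound (C := C₁ * (C₂ + C₃) * C)
    (F := fun l => comparison p q σ t l i j *
      (comparison p q σ 0 l 0 0 - I * comparison p q σ 0 l 0 1))
    (h := fun l => (fundMat p q l Real.pi).trace + 2 * σ) (hX.mul hξ) hh (fun z => ?_)
    (fun z => ?_) (by positivity) (fun z => ?_) ?_ ?_ l
  · by_cases hz : (fundMat p q z Real.pi).trace + 2 * σ = 0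
    · rw [hd z hz]; decide
    · rw [(hh.analyticAt z).analyticOrderAt_eq_zero.2 hz]; decide
  · by_cases hz : (fundMat p q z Real.pi).trace + 2 * σ = 0
    · rw [hd z hz]
      have hM := h.fundMat_pi_eq hσ hd hz
      have h1 : 1 ≤ analyticOrderAt (fun l => comparison p q σ t l i j) z := by
        rw [Order.one_le_iff_ne_zero, (hX.analyticAt z).analyticOrderAt_ne_zero,
          h.comparison_eq_zero hp hq hM t, Matrix.zero_apply]
      have h2 : 1 ≤ analyticOrderAt (fun l => comparison p q σ 0 l 0 0 -
          I * comparison p q σ 0 l 0 1) z := by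
        rw [Order.one_le_iff_ne_zero, (hξ.analyticAt z).analyticOrderAt_ne_zero,
          h.comparison_eq_zero hp hq hM 0]
        simp
      have h3 := analyticOrderAt_mul (hX.analyticAt z) (hξ.analyticAt z)
      calc (2 : ℕ∞) = 1 + 1 := by norm_num
        _ ≤ _ := add_le_add h1 h2
        _ = _ := h3.symm
    · rw [(hh.analyticAt z).analyticOrderAt_eq_zero.2 hz]
      exact zero_le
  · have hexp : Real.exp (|z.im| * (Real.pi / 2)) * Real.exp (|z.im| * (Real.pi / 2)) =
        Real.exp (|z.im| * Real.pi) := by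
      rw [← Real.exp_add]; ring_nf
    have hξb : ‖comparison p q σ 0 z 0 0 - I * comparison p q σ 0 z 0 1‖ ≤
        (C₂ + C₃) * Real.exp (|z.im| * (Real.pi / 2)) := by
      refine (norm_sub_le _ _).trans ?_
      rw [norm_mul, norm_I, one_mul, add_mul]
      exact add_le_add (hC₂ z) (hC₃ z)
    calc ‖comparison p q σ t z i j * (comparison p q σ 0 z 0 0 -
          I * comparison p q σ 0 z 0 1)‖ * z.im ^ 2
        ≤ (C₁ * Real.exp (|z.im| * (Real.pi / 2))) * ((C₂ + C₃) *
            Real.exp (|z.im| * (Real.pi / 2))) * z.im ^ 2 := by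
          rw [norm_mul]; gcongr; exact hC₁ z
      _ = C₁ * (C₂ + C₃) * (z.im ^ 2 * Real.exp (|z.im| * Real.pi)) := by rw [← hexp]; ring
      _ ≤ C₁ * (C₂ + C₃) * (C * (1 + z.im ^ 2) * ‖(fundMat p q z Real.pi).trace + 2 * σ‖) :=
          mul_le_mul_of_nonneg_left (hC z) (by positivity)
      _ = _ := by ring
  · have h1 := h.tendsto_comparison σ t i j
    have h2 := (h.tendsto_comparison σ 0 0 0).sub ((h.tendsto_comparison σ 0 0 1).const_mul I)
    have h3 := h.tendsto_trace Real.pi_pos (2 * (σ : ℂ))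
    have hT := comparisonLimit_sub σ
    have h4 := (h1.mul h2).div h3 one_ne_zero
    rw [hT, mul_one, div_one] at h4
    refine h4.congr fun z => ?_
    have hexp : cexp (I * z * (Real.pi : ℝ)) = cexp (I * z * (Real.pi / 2 : ℝ)) *
        cexp (I * z * (Real.pi / 2 : ℝ)) := by
      rw [← Complex.exp_add]; congr 1; push_cast; ring
    have h5 := Complex.exp_ne_zero (I * z * (Real.pi / 2 : ℝ))
    simp only [Pi.div_apply]
    rw [hexp]
    by_cases h6 : (fundMat p q z Real.pi).trace + 2 * σ = 0
    · simp [h6]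
    · field_simp
  · have h3 := (h.tendsto_trace Real.pi_pos (2 * (σ : ℂ))).eventually_ne one_ne_zero
    filter_upwards [h3] with z hz hz0
    exact hz (by rw [hz0, mul_zero])

/-- If all zeros of `Δ + 2 σ` are double, then `Q` is `π / 2`-periodic up to the sign `σ`. -/
theorem ae_eq_of_hasOnlyDoubleZeros (h : LocallyIntegrableEntries p q)
    (hp : Function.Periodic p Real.pi) (hq : Function.Periodic q Real.pi) {σ : ℝ}
    (hσ : σ ^ 2 = 1)
    (hd : HasOnlyDoubleZeros fun l => (fundMat p q l Real.pi).trace + 2 * σ) :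
    ∀ᵐ z, p (z + Real.pi / 2) = σ * p z ∧ q (z + Real.pi / 2) = σ * q z := by
  have hσ' : (σ : ℂ) ^ 2 = 1 := by exact_mod_cast hσ
  -- From here on only the nonreal parameter `l = i` is used, where `Δ + 2σ` cannot vanish.
  have hne : (fundMat p q I Real.pi).trace + 2 * σ ≠ 0 := fun h0 => by
    have := h.im_eq_zero_of_trace hσ h0
    simp at this
  set D := (fundMat p q I Real.pi).trace + 2 * σ with hD
  set ξ := comparison p q σ 0 I 0 0 - I * comparison p q σ 0 I 0 1 with hξ
  have key := fun t i j => h.comparison_mul_comparison hp hq hσ hd t I i j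
  have hT := comparisonLimit_sub σ
  have hξ0 : ξ ≠ 0 := by
    intro h0
    have h1 := key 0 0 0
    have h2 := key 0 0 1
    rw [← hξ, h0, mul_zero, ← hD] at h1 h2
    refine hne ?_
    linear_combination (-D) * hT - h1 + I * h2
  set α : ℂ := D / ξ * ((1 + σ) / 2) with hα
  set β : ℂ := D / ξ * (I * (1 - σ) / 2) with hβ
  -- The right side does not depend on `t`: this is where half-periodicity comes from.
  have hX : ∀ t, comparison p q σ t I = !![α, β; -β, α] := by
    intro t
    have h1 : ∀ i j, comparison p q σ t I i j = D / ξ * comparisonLimit σ i j := fun i j => by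
      have := key t i j
      rw [← hξ, ← hD] at this
      field_simp
      linear_combination this
    ext i j
    rw [h1, hα, hβ, comparisonLimit_eq]
    fin_cases i <;> fin_cases j <;> simp
  have hασ : σ * α = α := by rw [hα]; linear_combination (D / ξ / 2) * hσ'
  have hβσ : σ * β = -β := by rw [hβ]; linear_combination (-D / ξ / 2 * I) * hσ'
  have hαβ : α ^ 2 + β ^ 2 ≠ 0 := by
    have : α ^ 2 + β ^ 2 = (D / ξ) ^ 2 * σ := by
      rw [hα, hβ]
      linear_combination ((D / ξ) ^ 2 * ((1 - σ) / 2) ^ 2) * I_sq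
    rw [this]
    refine mul_ne_zero (pow_ne_zero _ (div_ne_zero hne hξ0)) fun h0 => ?_
    rw [h0] at hσ'
    norm_num at hσ'
  set K := (fundMat p q I Real.pi).adjugate + (σ : ℂ) • 1 with hK
  -- The right side solves the shifted system, since `K` is constant; the left side solves the
  -- system with potential `σ Q`.
  have hrel : ∀ t, !![α, β; -β, α] * fundMat p q I t = fundMat p q I (t + Real.pi / 2) * K :=
    fun t => by rw [← hX t, h.comparison_mul hp hq]
  have h1 : ∀ j, IsSolution (fun z => p (z + Real.pi / 2)) (fun z => q (z + Real.pi / 2)) I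
      (fun z => α * fundMat p q I z 0 j + β * fundMat p q I z 1 j)
      (fun z => -β * fundMat p q I z 0 j + α * fundMat p q I z 1 j) := by
    intro j
    have := ((h.isSolution I 0).shift (Real.pi / 2)).linear_comb
      ((h.isSolution I 1).shift (Real.pi / 2)) (K 0 j) (K 1 j)
    have e0 : ∀ z, K 0 j * fundMat p q I (z + Real.pi / 2) 0 0 +
        K 1 j * fundMat p q I (z + Real.pi / 2) 0 1 =
        α * fundMat p q I z 0 j + β * fundMat p q I z 1 j := fun z => by
      have := congrFun (congrFun (hrel z) 0) j
      rw [Matrix.mul_apply, Matrix.mul_apply, Fin.sum_univ_two, Fin.sum_univ_two] at this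
      simp at this
      linear_combination -this
    have e1 : ∀ z, K 0 j * fundMat p q I (z + Real.pi / 2) 1 0 +
        K 1 j * fundMat p q I (z + Real.pi / 2) 1 1 =
        -β * fundMat p q I z 0 j + α * fundMat p q I z 1 j := fun z => by
      have := congrFun (congrFun (hrel z) 1) j
      rw [Matrix.mul_apply, Matrix.mul_apply, Fin.sum_univ_two, Fin.sum_univ_two] at this
      simp at this
      linear_combination -this
    simp only [e0, e1] at this
    exact this
  have h2 := fun j => (h.isSolution I j).rotate hασ hβσ
  refine (h1 0).potential_ae_eq (h2 0) (h1 1) (h2 1) fun z => ?_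
  have hdet := h.det_fundMat I z
  rw [Matrix.det_fin_two] at hdet
  have e : (α * fundMat p q I z 0 0 + β * fundMat p q I z 1 0) *
      (-β * fundMat p q I z 0 1 + α * fundMat p q I z 1 1) -
      (-β * fundMat p q I z 0 0 + α * fundMat p q I z 1 0) *
      (α * fundMat p q I z 0 1 + β * fundMat p q I z 1 1) = α ^ 2 + β ^ 2 := by
    linear_combination (α ^ 2 + β ^ 2) * hdet
  rw [e]
  exact hαβ

/-- If `Q` is `π / 2`-periodic up to the sign `σ`, then all zeros of `Δ + 2 σ` are double. -/
theorem hasOnlyDoubleZeros_of_ae_eq (h : LocallyIntegrableEntries p q) {σ : ℝ}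
    (hσ : σ ^ 2 = 1)
    (hs : ∀ᵐ z, p (z + Real.pi / 2) = σ * p z ∧ q (z + Real.pi / 2) = σ * q z) :
    HasOnlyDoubleZeros fun l => (fundMat p q l Real.pi).trace + 2 * σ := by
  have hσ' : (σ : ℂ) ^ 2 = 1 := by exact_mod_cast hσ
  -- With these values `R` is `1` for `σ = 1` and `J` for `σ = -1`, so `R` carries solutions for `Q`
  -- to solutions for `σ Q`.
  set α : ℂ := (1 + σ) / 2 with hα
  set β : ℂ := (1 - σ) / 2 with hβ
  have hασ : σ * α = α := by rw [hα]; linear_combination (1 / 2) * hσ'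
  have hβσ : σ * β = -β := by rw [hβ]; linear_combination (-1 / 2) * hσ'
  set R : Matrix (Fin 2) (Fin 2) ℂ := !![α, β; -β, α] with hR
  have hRR : R * R = (σ : ℂ) • 1 := by
    rw [hR]
    ext i j
    fin_cases i <;> fin_cases j <;> simp [hα, hβ]
    · ring
    · linear_combination (-1 / 2) * hσ'
    · linear_combination (1 / 2) * hσ'
    · ring
  have hRdet : R.det = 1 := by
    rw [hR, Matrix.det_fin_two]
    simp [hα, hβ]
    linear_combination (1 / 2) * hσ'
  have hrel : ∀ l, R * fundMat p q l (Real.pi / 2) =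
      fundMat (fun z => p (z + Real.pi / 2)) (fun z => q (z + Real.pi / 2)) l
        (Real.pi / 2) * R := by
    intro l
    have h1 := (h.shift (Real.pi / 2)).mul_fundMat (l := l) (Y := fun z => R * fundMat p q l z)
      (fun j => by
        have := ((h.isSolution l j).rotate hασ hβσ).congr_potential
          (p' := fun z => p (z + Real.pi / 2)) (q' := fun z => q (z + Real.pi / 2))
          (by filter_upwards [hs] with z hz using hz.1.symm)
          (by filter_upwards [hs] with z hz using hz.2.symm)
        simpa [hR, Matrix.mul_apply, Fin.sum_univ_two] using this) (Real.pi / 2)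
    rw [h1, h.fundMat_zero, mul_one]
  set N : ℂ → Matrix (Fin 2) (Fin 2) ℂ := fun l => R * fundMat p q l (Real.pi / 2) with hN
  have hNN : ∀ l, N l * N l = (σ : ℂ) • fundMat p q l Real.pi := by
    intro l
    have h1 := h.fundMat_add l (Real.pi / 2) (Real.pi / 2)
    rw [add_halves] at h1
    rw [h1]
    simp only [hN]
    nth_rewrite 1 [hrel l]
    rw [mul_assoc, ← mul_assoc R, hRR, Matrix.smul_mul, one_mul, Matrix.mul_smul]
  have hNdet : ∀ l, (N l).det = 1 := fun l => by
    simp only [hN]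
    rw [Matrix.det_mul, hRdet, h.det_fundMat, one_mul]
  -- Cayley–Hamilton: `tr N² = (tr N)² - 2` when `det N = 1`.
  have htr : ∀ l, (fundMat p q l Real.pi).trace + 2 * σ = (σ * (N l).trace) * (N l).trace := by
    intro l
    have h1 := congrArg Matrix.trace (hNN l)
    have h2 := hNdet l
    rw [Matrix.trace_smul, Matrix.trace_fin_two, Matrix.mul_apply, Matrix.mul_apply,
      Fin.sum_univ_two, Fin.sum_univ_two, smul_eq_mul] at h1
    rw [Matrix.det_fin_two] at h2
    rw [Matrix.trace_fin_two (N l)]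
    linear_combination (-(fundMat p q l Real.pi).trace) * hσ' - σ * h1 - 2 * σ * h2
  have hder : ∀ l, HasDerivAt (fun l => (N l).trace)
      (-(N l * J * gram p q l l (Real.pi / 2)).trace) l := fun l =>
    h.hasDerivAt_trace_mul R l Real.pi_div_two_pos.le
  have hdiff : Differentiable ℂ fun l => (N l).trace := fun l => (hder l).differentiableAt
  have hσ0 : (σ : ℂ) ≠ 0 := fun h0 => by
    rw [h0] at hσ'
    norm_num at hσ'
  intro l hl
  have him := h.im_eq_zero_of_trace hσ hl
  obtain ⟨x, rfl⟩ : ∃ x : ℝ, l = x := ⟨l.re, by apply Complex.ext <;> simp [him]⟩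
  have hN0 : (N x).trace = 0 := by
    have h1 : (fundMat p q x Real.pi).trace + 2 * σ = 0 := hl
    rw [htr, mul_assoc, mul_eq_zero, mul_self_eq_zero] at h1
    exact h1.resolve_left hσ0
  -- Otherwise `N` would be scalar with trace 0, hence zero, against `det N = 1`.
  have hd0 : (N x * J * gram p q x x (Real.pi / 2)).trace ≠ 0 := by
    intro h0
    have hreal : ∀ i j, ((N x i j).re : ℂ) = N x i j := by
      intro i j
      have hRr : ∀ i j, ((R i j).re : ℂ) = R i j := by
        have e1 : α = (((1 + σ) / 2 : ℝ) : ℂ) := by rw [hα]; push_cast; ring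
        have e2 : β = (((1 - σ) / 2 : ℝ) : ℂ) := by rw [hβ]; push_cast; ring
        intro i j
        rw [hR, e1, e2]
        fin_cases i <;> fin_cases j <;> simp
      simp only [hN]
      rw [Matrix.mul_apply, Fin.sum_univ_two, ← hRr i 0, ← hRr i 1,
        ← h.fundMat_ofReal x _ 0 j, ← h.fundMat_ofReal x _ 1 j]
      simp
    have h1 := h.eq_smul_one_of_trace_eq_zero x Real.pi_div_two_pos hreal (hNdet x)
      (by rw [hN0]; simp) h0
    have h2 : N x 0 0 = 0 := by
      have h3 := hN0
      rw [h1, Matrix.trace_smul, Matrix.trace_one] at h3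
      simpa using h3
    have h4 := hNdet x
    rw [h1, h2, zero_smul] at h4
    simp at h4
  have o1 := (hdiff.analyticAt (x : ℂ)).analyticOrderAt_eq_one_of_zero_deriv_ne_zero hN0
    (by rw [(hder x).deriv]; exact neg_ne_zero.2 hd0)
  have hdiff' : Differentiable ℂ fun l => (σ : ℂ) * (N l).trace := hdiff.const_mul _
  have o2 := (hdiff'.analyticAt (x : ℂ)).analyticOrderAt_eq_one_of_zero_deriv_ne_zero
    (by rw [hN0, mul_zero])
    (by rw [((hder x).const_mul (σ : ℂ)).deriv]; exact mul_ne_zero hσ0 (neg_ne_zero.2 hd0))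
  simp only [htr]
  have := analyticOrderAt_mul (hdiff'.analyticAt (x : ℂ)) (hdiff.analyticAt (x : ℂ))
  rw [o1, o2] at this
  refine Eq.trans this ?_
  norm_num

end LocallyIntegrableEntries

end DiracSystem

/-! ### Reduction of the theorem to the real entries `p`, `q` and the signs `σ = 1` and `σ = -1` -/

theorem corollary5p3 (Q : ℝ → Matrix (Fin 2) (Fin 2) ℂ)
    (hherm : ∀ z, (Q z).IsHermitian)
    (hcan : DiracSystem.IsCanonical Q)
    (hper : Function.Periodic Q Real.pi)
    (hint : ∀ i j : Fin 2, IntegrableOn (fun z => Q z i j) (Set.Ico 0 Real.pi)) :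
    ((∀ᵐ z : ℝ, Q (z + Real.pi / 2) = Q z) ↔
      DiracSystem.HasOnlyDoubleZeros (fun lam => DiracSystem.discriminant Q lam + 2)) ∧
    ((∀ᵐ z : ℝ, Q (z + Real.pi / 2) = -Q z) ↔
      DiracSystem.HasOnlyDoubleZeros (fun lam => DiracSystem.discriminant Q lam - 2)) := by
  set p : ℝ → ℝ := fun z => (Q z 0 0).re with hp
  set q : ℝ → ℝ := fun z => (Q z 0 1).re with hq
  have hQ : Q = DiracSystem.canonicalPotential p q := by
    funext z
    have hc := hcan z
    have h00 : ((Q z 0 0).re : ℂ) = Q z 0 0 := by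
      have := (hherm z).apply 0 0
      exact Complex.conj_eq_iff_re.1 this
    have e00 := congrFun (congrFun hc 0) 0
    have e01 := congrFun (congrFun hc 0) 1
    have e10 := congrFun (congrFun hc 1) 0
    have e11 := congrFun (congrFun hc 1) 1
    simp [DiracSystem.antiPart, DiracSystem.sigma1, DiracSystem.sigma3] at e00 e01 e10 e11
    ext i j
    fin_cases i <;> fin_cases j
    · exact h00.symm
    · exact e01
    · exact e10
    · simp only [DiracSystem.canonicalPotential, hp, h00]
      simp
      linear_combination e00 + e11
  have hpp : Function.Periodic p Real.pi := fun z => by simp only [hp, hper z]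
  have hqp : Function.Periodic q Real.pi := fun z => by simp only [hq, hper z]
  have hloc : ∀ f : ℝ → ℝ, Function.Periodic f Real.pi → IntegrableOn f (Set.Ico 0 Real.pi) →
      ∀ a b, IntervalIntegrable f volume a b := fun f hf hi a b => by
    refine hf.intervalIntegrable₀ Real.pi_pos.ne' ?_ a b
    rw [intervalIntegrable_iff_integrableOn_Ico_of_le Real.pi_pos.le]
    exact hi
  have h : DiracSystem.LocallyIntegrableEntries p q :=
    ⟨hloc p hpp (hint 0 0).re, hloc q hqp (hint 0 1).re⟩
  have hiff : ∀ (σ : ℝ) (z : ℝ), Q (z + Real.pi / 2) = (σ : ℂ) • Q z ↔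
      p (z + Real.pi / 2) = σ * p z ∧ q (z + Real.pi / 2) = σ * q z := by
    intro σ z
    constructor
    · intro h0
      simp [hp, hq, h0]
    · rintro ⟨h1, h2⟩
      rw [hQ]
      simp only [DiracSystem.canonicalPotential, h1, h2]
      ext i j
      fin_cases i <;> fin_cases j <;> simp
  have main : ∀ σ : ℝ, σ ^ 2 = 1 → ((∀ᵐ z : ℝ, Q (z + Real.pi / 2) = (σ : ℂ) • Q z) ↔
      DiracSystem.HasOnlyDoubleZeros (fun lam => DiracSystem.discriminant Q lam + 2 * σ)) := by
    intro σ hσ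
    simp only [hiff, DiracSystem.discriminant]
    rw [hQ]
    exact ⟨h.hasOnlyDoubleZeros_of_ae_eq hσ, h.ae_eq_of_hasOnlyDoubleZeros hpp hqp hσ⟩
  constructor
  · simpa using main 1 (by norm_num)
  · simpa [sub_eq_add_neg] using main (-1) (by norm_num)
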